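/- Let $\mathcal E$ be a category with finite limits. A morphism $f\colon B\to A$ of $\mathcal E$ is *exponentiable* if the pullback functor $\Delta_f\colon \mathcal E/A\to\mathcal E/B$ has a right adjoint $\Pi_f$; write $\Sigma_f$ for the left adjoint of $\Delta_f$ (composition with $f$). **The category $\mathbf{Poly}_{\mathcal E}$.** Its objects (polynomials) are the exponentiable morphisms $p\colon P_*\to P$ of $\mathcal E$. A morphism $\varphi\colon p\to q$, where $q\colon Q_*\to Q$, is a pair of a morphism $\varphi_1\colon P\to Q$ and a morphism $\varphi^\sharp\colon P\times_Q Q_*\to P_*$ over $P$ (pairs over different choices of the pullback being identified along the canonical isomorphism). The composite of $\varphi\colon p\to q$ and $\psi\colon q\to r$ is $\psi_1\varphi_1$ together with $P\times_R R_*\cong P\times_Q(Q\times_R R_*)\xrightarrow{P\times_Q\psi^\sharp}P\times_Q Q_*\xrightarrow{\varphi^\sharp}P_*$. Let $y=\mathrm{id}_1$, and let $p\triangleleft q$ be the polynomial with base $\Pi_p(Q\times P_*)$ given by the composite $$\big(\Pi_p(Q\times P_*)\times_P P_*\big)\times_Q Q_*\to \Pi_p(Q\times P_*)\times_P P_*\to\Pi_p(Q\times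 P_*),$$ where $\Pi_p(Q\times P_*)\times_P P_*\to Q\times P_*\to Q$ is the counit of $\Delta_p\dashv\Pi_p$ followed by the projection. **Polynomial functors.** For a polynomial $p$ put $P(p)=\big(\mathcal E\xrightarrow{\Delta_!}\mathcal E/P_*\xrightarrow{\Pi_p}\mathcal E/P\xrightarrow{\Sigma_!}\mathcal E\big)$, where $!$ is the morphism to the terminal object. Thus a morphism $T\to P(p)(A)$ amounts to a pair of morphisms $T\to P$ and $T\times_P P_*\to A$. For $\varphi\colon p\to q$ let $P(\varphi)\colon P(p)\to P(q)$ be the composite of the following two transformations, where $w=\varphi^\sharp$ and $q'=p\,w\colon P\times_Q Q_*\to P$ is the pullback of $q$ along $\varphi_1$. * The vertical part $P(p)\to P(q')$ is $\Sigma_!$ applied to $$\Pi_p\Delta_!\to\Pi_{q'}\Delta_{q'}\Pi_p\Delta_!\cong\Pi_{q'}\Delta_w\Delta_p\Pi_p\Delta_!\to\Pi_{q'}\Delta_w\Delta_!\cong\Pi_{q'}\Delta_!,$$ given by the unit of $\Delta_{q'}\dashv\Pi_{q'}$ and the counit of $\Delta_p\dashv\Pi_p$; exponentiability of $w$ is not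 needed. * The cartesian part $P(q')\to P(q)$ is $$\Sigma_!\Pi_{q'}\Delta_!\cong\Sigma_!\Pi_{q'}\Delta_u\Delta_!\cong\Sigma_!\Delta_{\varphi_1}\Pi_q\Delta_!\cong\Sigma_!\Sigma_{\varphi_1}\Delta_{\varphi_1}\Pi_q\Delta_!\to\Sigma_!\Pi_q\Delta_!,$$ where $u\colon P\times_Q Q_*\to Q_*$ is the projection, the second isomorphism is the Beck–Chevalley isomorphism, the third is $\Sigma_!\cong\Sigma_!\Sigma_{\varphi_1}$, and the last arrow is the counit of $\Sigma_{\varphi_1}\dashv\Delta_{\varphi_1}$. **Strong endofunctors.** A *strength* on $F\colon\mathcal E\to\mathcal E$ is a family $\tau_{A,B}\colon A\times F(B)\to F(A\times B)$, natural in $A$ and $B$, such that, up to the coherence isomorphisms for products, $\tau_{1,B}=\mathrm{id}_{F(B)}$ and $\tau_{A\times A',B}=\tau_{A,A'\times B}\circ(\mathrm{id}_A\times\tau_{A',B})$. A natural transformation $\psi\colon (F,\tau)\to(F',\tau')$ is *strong* if $\tau'_{A,B}\circ(\mathrm{id}_A\times\psi_B)=\psi_{A\times B}\circ\tau_{A,B}$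 for all $A,B$. Let $\mathbf{StrFun}(\mathcal E,\mathcal E)$ be the category of endofunctors of $\mathcal E$ equipped with a strength and strong natural transformations, monoidal under composition $F\otimes G=F\circ G$ (with strength $F(\tau^G_{A,B})\circ\tau^F_{A,G(B)}$). Each $P(p)$ has the canonical strength $A\times P(p)(B)\to P(p)(A\times B)$ which keeps the position in $P$ and sends a direction to the pair of the given element of $A$ and the value in $B$. **Theorem.** For every category $\mathcal E$ with finite limits, the assignment $p\mapsto P(p)$, $\varphi\mapsto P(\varphi)$ is a functor $$P\colon\mathbf{Poly}_{\mathcal E}\to\mathbf{StrFun}(\mathcal E,\mathcal E)$$ which is full and faithful. Moreover, $P$ is a monoidal functor: there is exactly one structure of monoidal category on $\mathbf{Poly}_{\mathcal E}$ with product $\triangleleft$ on objects and unit $y$ for which $P$ is a (strong) monoidal functor with the following canonical comparison morphisms, all of which are then isomorphisms. The unit comparison $A\to P(y)(A)$ corresponds to the projection $A\times_1 1\to A$. The comparison $P(p)(P(q)(A))\to P(p\triangleleft q)(A)$ has as its component to the base $\Pi_p(Q\times P_*)=P(p)(Q)$ the morphism $P(p)$ applied to the projection $P(q)(A)\to Q$,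 and sends a direction, that is a compatible pair of a direction of $p$ and a direction of $q$, to the result of evaluating at the first and then at the second. -/

import Mathlib

open CategoryTheory CategoryTheory.Limits

universe v u

noncomputable section

namespace CatPoly

attribute [local simp] pullback.lift_fst pullback.lift_snd pullback.lift_fst_assoc
  pullback.lift_snd_assoc prod.lift_fst prod.lift_snd prod.lift_fst_assoc prod.lift_snd_assoc

variable {E : Type u} [Category.{v} E] [HasFiniteLimits E]

/-- A morphism `f : B ⟶ A` is exponentiable if the pullback functor `E/A ⥤ E/B` has a right
adjoint. -/
abbrev Exponentiable {B A : E} (f : B ⟶ A) : Prop :=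
  (Over.pullback f).IsLeftAdjoint

/-- The right adjoint `Π_f` of the pullback functor along an exponentiable morphism. -/
abbrev pushforward {B A : E} (f : B ⟶ A) [Exponentiable f] : Over B ⥤ Over A :=
  (Over.pullback f).rightAdjoint

/-- The adjunction `Δ_f ⊣ Π_f`. -/
abbrev pushAdj {B A : E} (f : B ⟶ A) [Exponentiable f] :
    Over.pullback f ⊣ pushforward f :=
  Adjunction.ofIsLeftAdjoint (Over.pullback f)

lemma exponentiable_id (A : E) : Exponentiable (𝟙 A) :=
  Functor.isLeftAdjoint_of_iso (Over.pullbackId (X := A)).symm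

lemma exponentiable_comp {C B A : E} (g : C ⟶ B) (f : B ⟶ A) [Exponentiable g]
    [Exponentiable f] : Exponentiable (g ≫ f) :=
  Functor.isLeftAdjoint_of_iso (Over.pullbackComp g f).symm

/-- Exponentiable morphisms are stable under pullback. -/
instance exponentiable_pullback {A' B A : E} (a : A' ⟶ A) (f : B ⟶ A) [Exponentiable f] :
    Exponentiable (pullback.fst a f) := by
  let F : Over A' ⥤ Over (pullback a f) :=
    (Over.mk a).iteratedSliceBackward ⋙ Over.post (Over.pullback f) ⋙
      ((Over.pullback f).obj (Over.mk a)).iteratedSliceForward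
  have h1 : (Over.mk a).iteratedSliceBackward.IsLeftAdjoint :=
    inferInstanceAs (Over.mk a).iteratedSliceEquiv.inverse.IsLeftAdjoint
  have h2 : ((Over.pullback f).obj (Over.mk a)).iteratedSliceForward.IsLeftAdjoint :=
    inferInstanceAs ((Over.pullback f).obj (Over.mk a)).iteratedSliceEquiv.functor.IsLeftAdjoint
  have : F.IsLeftAdjoint := inferInstance
  have k1 {Y : E} (y : Y ⟶ A') : (pullbackRightPullbackFstIso a f y).hom ≫
        pullback.lift (pullback.fst (y ≫ a) f ≫ y) (pullback.snd (y ≫ a) f)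
          (by simp [pullback.condition]) = pullback.snd y (pullback.fst a f) := by
    apply pullback.hom_ext
    · simp [← pullback.condition]
    · simp
  have k2 {X Y : E} (x : X ⟶ A') (y : Y ⟶ A') (g : X ⟶ Y) (w : g ≫ y = x) :
      (pullbackRightPullbackFstIso a f x).hom ≫
          pullback.lift (pullback.fst (x ≫ a) f ≫ g) (pullback.snd (x ≫ a) f)
            (by simp [← pullback.condition, reassoc_of% w]) =
        pullback.lift (pullback.fst x (pullback.fst a f) ≫ g)
          (pullback.snd x (pullback.fst a f)) (by simp [w, pullback.condition]) ≫
          (pullbackRightPullbackFstIso a f y).hom := by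
    apply pullback.hom_ext <;> simp
  let e : F ≅ Over.pullback (pullback.fst a f) := NatIso.ofComponents
    (fun Y => (Over.isoMk (pullbackRightPullbackFstIso a f Y.hom) (k1 Y.hom)).symm)
    (fun {X Y} g => by
      rw [Iso.symm_hom, Iso.symm_hom, Iso.comp_inv_eq, Category.assoc, Iso.eq_inv_comp]
      ext
      exact k2 X.hom Y.hom g.left (Over.w g))
  exact Functor.isLeftAdjoint_of_iso e

/-- The functor `A ↦ (A × X ⟶ X)` from `E` to `E/X`, that is, pullback along `X ⟶ 1`. -/
@[simps]
def prodOver (X : E) : E ⥤ Over X where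
  obj A := Over.mk (prod.snd : A ⨯ X ⟶ X)
  map f := Over.homMk (prod.map f (𝟙 X)) (by simp)
  map_id A := by ext; simp
  map_comp f g := by ext; simp

/-- The counit `Δ_f Π_f Z ⟶ Z`, as a morphism of `E`. -/
def evMap {B A : E} (f : B ⟶ A) [Exponentiable f] (Z : Over B) :
    pullback ((pushforward f).obj Z).hom f ⟶ Z.left :=
  ((pushAdj f).counit.app Z).left

lemma evMap_hom {B A : E} (f : B ⟶ A) [Exponentiable f] (Z : Over B) :
    evMap f Z ≫ Z.hom = pullback.snd _ _ :=
  Over.w ((pushAdj f).counit.app Z)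

/-- Evaluation of a generalized element of `Π_f Z` at a generalized element of `B`. -/
def evalAt {B A : E} (f : B ⟶ A) [Exponentiable f] (Z : Over B) {T : E}
    (x : T ⟶ ((pushforward f).obj Z).left) (d : T ⟶ B)
    (h : x ≫ ((pushforward f).obj Z).hom = d ≫ f) : T ⟶ Z.left :=
  pullback.lift x d h ≫ evMap f Z

lemma evalAt_hom {B A : E} (f : B ⟶ A) [Exponentiable f] (Z : Over B) {T : E}
    (x : T ⟶ ((pushforward f).obj Z).left) (d : T ⟶ B)
    (h : x ≫ ((pushforward f).obj Z).hom = d ≫ f) : evalAt f Z x d h ≫ Z.hom = d := by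
  rw [evalAt, Category.assoc, evMap_hom, pullback.lift_snd]

lemma comp_evalAt {B A : E} (f : B ⟶ A) [Exponentiable f] (Z : Over B) {S T : E} (a : S ⟶ T)
    (x : T ⟶ ((pushforward f).obj Z).left) (d : T ⟶ B)
    (h : x ≫ ((pushforward f).obj Z).hom = d ≫ f) :
    a ≫ evalAt f Z x d h = evalAt f Z (a ≫ x) (a ≫ d) (by simp [h]) := by
  rw [evalAt, evalAt, ← Category.assoc]
  congr 1
  apply pullback.hom_ext <;> simp

lemma evalAt_homEquiv {B A : E} (f : B ⟶ A) [Exponentiable f] {Z : Over B} {X : Over A} {T : E}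
    (y : X ⟶ (pushforward f).obj Z) (t : (Over.pullback f).obj X ⟶ Z)
    (hy : y = (pushAdj f).homEquiv X Z t) (x : T ⟶ X.left) (d : T ⟶ B)
    (h : x ≫ X.hom = d ≫ f)
    (h' : (x ≫ y.left) ≫ ((pushforward f).obj Z).hom = d ≫ f) :
    evalAt f Z (x ≫ y.left) d h' =
      pullback.lift x d h ≫ (show pullback X.hom f ⟶ Z.left from t.left) := by
  have e := (pushAdj f).homEquiv_counit X Z y
  rw [(Equiv.symm_apply_eq _).2 hy] at e
  have w : y.left ≫ ((pushforward f).obj Z).hom = X.hom := Over.w _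
  have e' : (show pullback X.hom f ⟶ Z.left from t.left) =
      pullback.lift (pullback.fst _ _ ≫ y.left) (pullback.snd _ _)
        (by rw [Category.assoc, w, pullback.condition]) ≫ evMap f Z :=
    congrArg (fun k => k.left) e
  rw [e', evalAt, ← Category.assoc]
  congr 1
  apply pullback.hom_ext <;> simp

/-- Two generalized elements of `Π_f Z` over the same element of the base agree as soon as all
their evaluations do. -/
lemma pushforward_hom_ext {B A : E} (f : B ⟶ A) [Exponentiable f] {Z : Over B} {T : E}
    (x y : T ⟶ ((pushforward f).obj Z).left)
    (h : x ≫ ((pushforward f).obj Z).hom = y ≫ ((pushforward f).obj Z).hom)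
    (H : ∀ (S : E) (a : S ⟶ T) (d : S ⟶ B) (hx : (a ≫ x) ≫ ((pushforward f).obj Z).hom = d ≫ f)
      (hy : (a ≫ y) ≫ ((pushforward f).obj Z).hom = d ≫ f),
      evalAt f Z (a ≫ x) d hx = evalAt f Z (a ≫ y) d hy) : x = y := by
  let X : Over A := Over.mk (x ≫ ((pushforward f).obj Z).hom)
  let x' : X ⟶ (pushforward f).obj Z := Over.homMk x rfl
  let y' : X ⟶ (pushforward f).obj Z := Over.homMk y h.symm
  suffices x' = y' from congrArg (fun k => k.left) this
  apply ((pushAdj f).homEquiv X Z).symm.injective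
  rw [Adjunction.homEquiv_counit, Adjunction.homEquiv_counit]
  ext
  have := H (pullback X.hom f) (pullback.fst _ _) (pullback.snd _ _)
    (by rw [Category.assoc]; exact pullback.condition)
    (by rw [Category.assoc, ← h]; exact pullback.condition)
  exact this

/-- Evaluation is compatible with the functor `Π_f`. -/
lemma evalAt_map {B A : E} (f : B ⟶ A) [Exponentiable f] {Z W : Over B} (k : Z ⟶ W) {T : E}
    (x : T ⟶ ((pushforward f).obj Z).left) (d : T ⟶ B)
    (h : x ≫ ((pushforward f).obj Z).hom = d ≫ f)
    (h' : (x ≫ ((pushforward f).map k).left) ≫ ((pushforward f).obj W).hom = d ≫ f) :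
    evalAt f W (x ≫ ((pushforward f).map k).left) d h' = evalAt f Z x d h ≫ k.left := by
  have e := congrArg (fun k => k.left) ((pushAdj f).counit.naturality k)
  have w : ((pushforward f).map k).left ≫ ((pushforward f).obj W).hom =
    ((pushforward f).obj Z).hom := Over.w _
  have e' : pullback.lift (pullback.fst _ _ ≫ ((pushforward f).map k).left) (pullback.snd _ _)
        (by rw [Category.assoc, w, pullback.condition]) ≫ evMap f W =
      evMap f Z ≫ k.left := e
  rw [evalAt, evalAt, Category.assoc, ← e', ← Category.assoc]
  congr 1
  apply pullback.hom_ext <;> simp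

/-- The canonical isomorphism `Δ_{wf} ≅ Δ_w Δ_f`. -/
def pullbackCompHom {Y X B : E} (w : Y ⟶ X) (f : X ⟶ B) :
    Over.pullback (w ≫ f) ⟶ Over.pullback f ⋙ Over.pullback w where
  app Z := Over.homMk
    (show pullback Z.hom (w ≫ f) ⟶ pullback (pullback.snd Z.hom f) w from
      pullback.lift (pullback.lift (pullback.fst _ _) (pullback.snd _ _ ≫ w)
        (by rw [Category.assoc]; exact pullback.condition)) (pullback.snd _ _) (by simp))
    (pullback.lift_snd _ _ _)
  naturality Z W k := by
    have key {U V : E} (z : U ⟶ B) (v : V ⟶ B) (k : U ⟶ V) (hk : k ≫ v = z) :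
        pullback.lift (pullback.fst z (w ≫ f) ≫ k) (pullback.snd z (w ≫ f))
            (by rw [Category.assoc, hk, pullback.condition]) ≫
          (pullback.lift (pullback.lift (pullback.fst v (w ≫ f)) (pullback.snd v (w ≫ f) ≫ w)
            (by rw [Category.assoc, pullback.condition])) (pullback.snd v (w ≫ f)) (by simp) :
            pullback v (w ≫ f) ⟶ pullback (pullback.snd v f) w) =
        (pullback.lift (pullback.lift (pullback.fst z (w ≫ f)) (pullback.snd z (w ≫ f) ≫ w)
            (by rw [Category.assoc, pullback.condition])) (pullback.snd z (w ≫ f)) (by simp) :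
            pullback z (w ≫ f) ⟶ pullback (pullback.snd z f) w) ≫
          pullback.lift (pullback.fst (pullback.snd z f) w ≫
            pullback.lift (pullback.fst z f ≫ k) (pullback.snd z f)
              (by rw [Category.assoc, hk, pullback.condition]))
            (pullback.snd (pullback.snd z f) w) (by simp [pullback.condition]) := by
      refine pullback.hom_ext (pullback.hom_ext ?_ ?_) ?_ <;> simp
    ext
    exact key Z.hom W.hom k.left (Over.w k)

/-- The canonical isomorphism `Δ_w (A × X) ≅ A × Y` over `Y`. -/
def pullbackProdOver {Y X : E} (w : Y ⟶ X) : prodOver X ⋙ Over.pullback w ⟶ prodOver Y where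
  app A := Over.homMk
    (show pullback (prod.snd : A ⨯ X ⟶ X) w ⟶ A ⨯ Y from
      prod.lift (pullback.fst _ _ ≫ prod.fst) (pullback.snd _ _)) (prod.lift_snd _ _)
  naturality A B k := by
    have key : pullback.lift (pullback.fst (prod.snd : A ⨯ X ⟶ X) w ≫ prod.map k (𝟙 X))
          (pullback.snd (prod.snd : A ⨯ X ⟶ X) w) (by simp [pullback.condition]) ≫
        prod.lift (pullback.fst (prod.snd : B ⨯ X ⟶ X) w ≫ prod.fst)
          (pullback.snd (prod.snd : B ⨯ X ⟶ X) w) =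
        prod.lift (pullback.fst (prod.snd : A ⨯ X ⟶ X) w ≫ prod.fst)
          (pullback.snd (prod.snd : A ⨯ X ⟶ X) w) ≫ prod.map k (𝟙 Y) := by
      apply prod.hom_ext <;> simp
    ext
    exact key

/-- The canonical isomorphism `A × Y ≅ Δ_w (A × X)` over `Y`. -/
def prodOverPullback {Y X : E} (w : Y ⟶ X) : prodOver Y ⟶ prodOver X ⋙ Over.pullback w where
  app A := Over.homMk
    (show A ⨯ Y ⟶ pullback (prod.snd : A ⨯ X ⟶ X) w from
      pullback.lift (prod.map (𝟙 A) w) prod.snd (by simp)) (pullback.lift_snd _ _ _)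
  naturality A B k := by
    have key : prod.map k (𝟙 Y) ≫
          pullback.lift (f := (prod.snd : B ⨯ X ⟶ X)) (g := w) (prod.map (𝟙 B) w) prod.snd
            (by simp) =
        pullback.lift (f := (prod.snd : A ⨯ X ⟶ X)) (g := w) (prod.map (𝟙 A) w) prod.snd
            (by simp) ≫
          pullback.lift (pullback.fst (prod.snd : A ⨯ X ⟶ X) w ≫ prod.map k (𝟙 X))
            (pullback.snd (prod.snd : A ⨯ X ⟶ X) w) (by simp [pullback.condition]) := by
      apply pullback.hom_ext <;> simp
    ext
    exact key

/-- For `f' = w ≫ f`, the natural transformation `Π_f Δ_! ⟶ Π_{f'} Δ_!` given by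
`Π_f Δ_! ⟶ Π_{f'} Δ_{f'} Π_f Δ_! ≅ Π_{f'} Δ_w Δ_f Π_f Δ_! ⟶ Π_{f'} Δ_w Δ_! ≅ Π_{f'} Δ_!`,
the first arrow being the unit of `Δ_{f'} ⊣ Π_{f'}` and the third one the counit of
`Δ_f ⊣ Π_f`. No exponentiability of `w` is involved. -/
def verticalTrans {Y X B : E} (w : Y ⟶ X) (f : X ⟶ B) [Exponentiable f]
    [Exponentiable (w ≫ f)] :
    prodOver X ⋙ pushforward f ⟶ prodOver Y ⋙ pushforward (w ≫ f) :=
  Functor.whiskerLeft (prodOver X ⋙ pushforward f) (pushAdj (w ≫ f)).unit ≫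
  Functor.whiskerRight
    (Functor.whiskerLeft (prodOver X ⋙ pushforward f) (pullbackCompHom w f) ≫
      Functor.whiskerRight (Functor.whiskerLeft (prodOver X) (pushAdj f).counit)
        (Over.pullback w) ≫ pullbackProdOver w)
    (pushforward (w ≫ f))

/-- For a pullback square, the canonical isomorphism `Δ_f Σ_v ≅ Σ_u Δ_{f'}`. -/
def baseChange {Y' Y B' B : E} {u : Y' ⟶ Y} {f' : Y' ⟶ B'} {f : Y ⟶ B} {v : B' ⟶ B}
    (sq : IsPullback u f' f v) :
    Over.map v ⋙ Over.pullback f ⟶ Over.pullback f' ⋙ Over.map u where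
  app Z := Over.homMk
    (show pullback (Z.hom ≫ v) f ⟶ pullback Z.hom f' from
      pullback.lift (pullback.fst _ _)
        (sq.lift (pullback.snd _ _) (pullback.fst _ _ ≫ Z.hom)
          (by rw [Category.assoc]; exact pullback.condition.symm)) (by simp))
    (by
      have key {V : E} (z : V ⟶ B') (h1 : pullback.snd (z ≫ v) f ≫ f =
          (pullback.fst (z ≫ v) f ≫ z) ≫ v) (h2 : pullback.fst (z ≫ v) f ≫ z =
          sq.lift (pullback.snd (z ≫ v) f) (pullback.fst (z ≫ v) f ≫ z) h1 ≫ f') :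
          pullback.lift (pullback.fst (z ≫ v) f) (sq.lift (pullback.snd (z ≫ v) f)
            (pullback.fst (z ≫ v) f ≫ z) h1) h2 ≫ pullback.snd z f' ≫ u =
          pullback.snd (z ≫ v) f := by simp
      exact key Z.hom _ _)
  naturality Z W k := by
    have key {V V' : E} (z : V ⟶ B') (z' : V' ⟶ B') (k : V ⟶ V') (hk : k ≫ z' = z)
        (h1 : pullback.snd (z ≫ v) f ≫ f = (pullback.fst (z ≫ v) f ≫ z) ≫ v)
        (h2 : pullback.fst (z ≫ v) f ≫ z =
          sq.lift (pullback.snd (z ≫ v) f) (pullback.fst (z ≫ v) f ≫ z) h1 ≫ f')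
        (h1' : pullback.snd (z' ≫ v) f ≫ f = (pullback.fst (z' ≫ v) f ≫ z') ≫ v)
        (h2' : pullback.fst (z' ≫ v) f ≫ z' =
          sq.lift (pullback.snd (z' ≫ v) f) (pullback.fst (z' ≫ v) f ≫ z') h1' ≫ f')
        (h3 : (pullback.fst (z ≫ v) f ≫ k) ≫ z' ≫ v = pullback.snd (z ≫ v) f ≫ f)
        (h4 : (pullback.fst z f' ≫ k) ≫ z' = pullback.snd z f' ≫ f') :
        pullback.lift (pullback.fst (z ≫ v) f ≫ k) (pullback.snd (z ≫ v) f) h3 ≫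
          pullback.lift (pullback.fst (z' ≫ v) f) (sq.lift (pullback.snd (z' ≫ v) f)
            (pullback.fst (z' ≫ v) f ≫ z') h1') h2' =
        pullback.lift (pullback.fst (z ≫ v) f) (sq.lift (pullback.snd (z ≫ v) f)
            (pullback.fst (z ≫ v) f ≫ z) h1) h2 ≫
          pullback.lift (pullback.fst z f' ≫ k) (pullback.snd z f') h4 := by
      apply pullback.hom_ext
      · simp
      · apply sq.hom_ext <;> simp [hk]
    ext
    exact key Z.hom W.hom k.left (Over.w k) _ _ _ _ _ _

/-- For a pullback square, the Beck-Chevalley isomorphism `Π_{f'} Δ_u ≅ Δ_v Π_f`, the conjugate of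
`Δ_f Σ_v ≅ Σ_u Δ_{f'}`. -/
def beckChevalley {Y' Y B' B : E} {u : Y' ⟶ Y} {f' : Y' ⟶ B'} {f : Y ⟶ B} {v : B' ⟶ B}
    (sq : IsPullback u f' f v) [Exponentiable f] [Exponentiable f'] :
    Over.pullback u ⋙ pushforward f' ⟶ pushforward f ⋙ Over.pullback v :=
  conjugateEquiv ((pushAdj f').comp (Over.mapPullbackAdj u))
    ((Over.mapPullbackAdj v).comp (pushAdj f)) (baseChange sq)

/-- The natural transformation `Σ_! Π_{f'} Δ_! ⟶ Σ_! Π_f Δ_!` of a pullback square, given by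
`Σ_! Π_{f'} Δ_! ≅ Σ_! Π_{f'} Δ_u Δ_! ≅ Σ_! Δ_v Π_f Δ_! = Σ_! Σ_v Δ_v Π_f Δ_! ⟶ Σ_! Π_f Δ_!`,
the last arrow being the counit of `Σ_v ⊣ Δ_v`. -/
def cartesianTrans {Y' Y B' B : E} {u : Y' ⟶ Y} {f' : Y' ⟶ B'} {f : Y ⟶ B} {v : B' ⟶ B}
    (sq : IsPullback u f' f v) [Exponentiable f] [Exponentiable f'] :
    prodOver Y' ⋙ pushforward f' ⋙ Over.forget B' ⟶
      prodOver Y ⋙ pushforward f ⋙ Over.forget B :=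
  Functor.whiskerRight (prodOverPullback u) (pushforward f' ⋙ Over.forget B') ≫
  Functor.whiskerLeft (prodOver Y) (Functor.whiskerRight (beckChevalley sq) (Over.forget B')) ≫
  Functor.whiskerLeft (prodOver Y ⋙ pushforward f)
    (Functor.whiskerRight (Over.mapPullbackAdj v).counit (Over.forget B))

lemma evalAt_verticalTrans {Y X B : E} (w : Y ⟶ X) (f : X ⟶ B) [Exponentiable f]
    [Exponentiable (w ≫ f)] (A : E) {T : E}
    (x : T ⟶ ((pushforward f).obj ((prodOver X).obj A)).left) (d : T ⟶ Y)
    (h : x ≫ ((pushforward f).obj ((prodOver X).obj A)).hom = d ≫ w ≫ f)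
    (h' : (x ≫ ((verticalTrans w f).app A).left) ≫
      ((pushforward (w ≫ f)).obj ((prodOver Y).obj A)).hom = d ≫ w ≫ f) :
    evalAt (w ≫ f) ((prodOver Y).obj A) (x ≫ ((verticalTrans w f).app A).left) d h' =
      prod.lift (evalAt f ((prodOver X).obj A) x (d ≫ w) (by simpa using h) ≫ prod.fst) d := by
  have e : (verticalTrans w f).app A = (pushAdj (w ≫ f)).homEquiv _ _
      ((pullbackCompHom w f).app _ ≫
        (Over.pullback w).map ((pushAdj f).counit.app ((prodOver X).obj A)) ≫
          (pullbackProdOver w).app A) := by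
    rw [Adjunction.homEquiv_unit]
    rfl
  refine (evalAt_homEquiv (w ≫ f) _ _ e x d h h').trans ?_
  have key {V : E} (z : V ⟶ B) (ev : pullback z f ⟶ A ⨯ X) (hev : ev ≫ prod.snd = pullback.snd z f)
      (x : T ⟶ V) (h : x ≫ z = d ≫ w ≫ f) :
      pullback.lift x d h ≫
        (pullback.lift (pullback.lift (pullback.fst z (w ≫ f)) (pullback.snd z (w ≫ f) ≫ w)
            (by rw [Category.assoc, pullback.condition])) (pullback.snd z (w ≫ f)) (by simp) :
            pullback z (w ≫ f) ⟶ pullback (pullback.snd z f) w) ≫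
        pullback.lift (f := (prod.snd : A ⨯ X ⟶ X)) (g := w)
          (pullback.fst (pullback.snd z f) w ≫ ev) (pullback.snd (pullback.snd z f) w)
          (by rw [Category.assoc, hev, pullback.condition]) ≫
        prod.lift (pullback.fst (prod.snd : A ⨯ X ⟶ X) w ≫ prod.fst)
          (pullback.snd (prod.snd : A ⨯ X ⟶ X) w) =
      prod.lift ((pullback.lift x (d ≫ w) (by simpa using h) ≫ ev) ≫ prod.fst) d := by
    apply prod.hom_ext
    · simp only [Category.assoc, prod.lift_fst, pullback.lift_fst_assoc]
      simp only [← Category.assoc]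
      congr 2
      apply pullback.hom_ext <;> simp
    · simp
  exact key _ (evMap f _) (evMap_hom f _) x h

lemma beckChevalley_comp_fst_hom {Y' Y B' B : E} {u : Y' ⟶ Y} {f' : Y' ⟶ B'} {f : Y ⟶ B}
    {v : B' ⟶ B} (sq : IsPullback u f' f v) [Exponentiable f] [Exponentiable f'] (Z : Over Y) :
    (((beckChevalley sq).app Z).left ≫ pullback.fst ((pushforward f).obj Z).hom v) ≫
      ((pushforward f).obj Z).hom =
    ((pushforward f').obj ((Over.pullback u).obj Z)).hom ≫ v := by
  have w : ((beckChevalley sq).app Z).left ≫ pullback.snd ((pushforward f).obj Z).hom v =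
    ((pushforward f').obj ((Over.pullback u).obj Z)).hom := Over.w _
  have key {U V : E} (z : V ⟶ B) (b : U ⟶ pullback z v) (z' : U ⟶ B')
      (hb : b ≫ pullback.snd z v = z') : (b ≫ pullback.fst z v) ≫ z = z' ≫ v := by
    rw [← hb, Category.assoc, Category.assoc, pullback.condition]
  exact key _ _ _ w

lemma evalAt_beckChevalley {Y' Y B' B : E} {u : Y' ⟶ Y} {f' : Y' ⟶ B'} {f : Y ⟶ B}
    {v : B' ⟶ B} (sq : IsPullback u f' f v) [Exponentiable f] [Exponentiable f'] (Z : Over Y)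
    {T : E} (x : T ⟶ ((pushforward f').obj ((Over.pullback u).obj Z)).left) (d : T ⟶ Y')
    (h : x ≫ ((pushforward f').obj ((Over.pullback u).obj Z)).hom = d ≫ f')
    (h' : (x ≫ ((beckChevalley sq).app Z).left ≫
      pullback.fst ((pushforward f).obj Z).hom v) ≫ ((pushforward f).obj Z).hom = (d ≫ u) ≫ f) :
    evalAt f Z (x ≫ ((beckChevalley sq).app Z).left ≫
        pullback.fst ((pushforward f).obj Z).hom v) (d ≫ u) h' =
      (show T ⟶ pullback Z.hom u from evalAt f' ((Over.pullback u).obj Z) x d h) ≫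
        pullback.fst Z.hom u := by
  have e := conjugateEquiv_counit ((pushAdj f').comp (Over.mapPullbackAdj u))
    ((Over.mapPullbackAdj v).comp (pushAdj f)) (baseChange sq) Z
  rw [Adjunction.comp_counit_app, Adjunction.comp_counit_app, Over.mapPullbackAdj_counit_app,
    Over.mapPullbackAdj_counit_app] at e
  have e' := congrArg (fun k => k.left) e
  have key {U V W : E} (zf : V ⟶ B) (z' : U ⟶ B') (z : W ⟶ Y) (b : U ⟶ pullback zf v)
      (hb : b ≫ pullback.snd zf v = z') (ev : pullback zf f ⟶ W)
      (ev' : pullback z' f' ⟶ pullback z u)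
      (h1 : (pullback.fst (z' ≫ v) f ≫ b) ≫ pullback.snd zf v ≫ v = pullback.snd (z' ≫ v) f ≫ f)
      (h2 : (pullback.fst (pullback.snd zf v ≫ v) f ≫ pullback.fst zf v) ≫ zf =
        pullback.snd (pullback.snd zf v ≫ v) f ≫ f)
      (h3 : pullback.snd (z' ≫ v) f ≫ f = (pullback.fst (z' ≫ v) f ≫ z') ≫ v)
      (h4 : pullback.fst (z' ≫ v) f ≫ z' =
          sq.lift (pullback.snd (z' ≫ v) f) (pullback.fst (z' ≫ v) f ≫ z') h3 ≫ f')
      (e : pullback.lift (pullback.fst (z' ≫ v) f ≫ b) (pullback.snd (z' ≫ v) f) h1 ≫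
        pullback.lift (pullback.fst (pullback.snd zf v ≫ v) f ≫ pullback.fst zf v)
          (pullback.snd (pullback.snd zf v ≫ v) f) h2 ≫ ev =
        pullback.lift (pullback.fst (z' ≫ v) f) (sq.lift (pullback.snd (z' ≫ v) f)
            (pullback.fst (z' ≫ v) f ≫ z') h3) h4 ≫ ev' ≫ pullback.fst z u)
      (x : T ⟶ U) (h : x ≫ z' = d ≫ f')
      (h' : (x ≫ b ≫ pullback.fst zf v) ≫ zf = (d ≫ u) ≫ f) :
      pullback.lift (x ≫ b ≫ pullback.fst zf v) (d ≫ u) h' ≫ ev =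
        (pullback.lift x d h ≫ ev') ≫ pullback.fst z u := by
    have hx : x ≫ z' ≫ v = (d ≫ u) ≫ f := by
      rw [← Category.assoc, h, Category.assoc, Category.assoc, sq.w]
    have e2 := congrArg (fun k => pullback.lift x (d ≫ u) hx ≫ k) e
    simp only [← Category.assoc] at e2
    convert e2 using 2
    · apply pullback.hom_ext <;> simp
    · congr 1
      apply pullback.hom_ext
      · simp
      · apply sq.hom_ext <;> simp [h]
  exact key _ _ _ _ (Over.w ((beckChevalley sq).app Z)) (evMap f Z)
    (evMap f' ((Over.pullback u).obj Z)) _ _ _ _ e' x h h'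

/-- The component of `cartesianTrans` at `A`. -/
def cartesianApp {Y' Y B' B : E} {u : Y' ⟶ Y} {f' : Y' ⟶ B'} {f : Y ⟶ B}
    {v : B' ⟶ B} (sq : IsPullback u f' f v) [Exponentiable f] [Exponentiable f'] (A : E) :
    ((pushforward f').obj ((prodOver Y').obj A)).left ⟶
      ((pushforward f).obj ((prodOver Y).obj A)).left :=
  (cartesianTrans sq).app A

lemma cartesianApp_eq {Y' Y B' B : E} {u : Y' ⟶ Y} {f' : Y' ⟶ B'} {f : Y ⟶ B}
    {v : B' ⟶ B} (sq : IsPullback u f' f v) [Exponentiable f] [Exponentiable f'] (A : E) :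
    cartesianApp sq A =
      ((pushforward f').map ((prodOverPullback u).app A)).left ≫
        ((beckChevalley sq).app ((prodOver Y).obj A)).left ≫
          pullback.fst ((pushforward f).obj ((prodOver Y).obj A)).hom v := by
  have e := congrArg (fun k => k.left)
    (Over.mapPullbackAdj_counit_app v ((pushforward f).obj ((prodOver Y).obj A)))
  have e' : ((Over.mapPullbackAdj v).counit.app
      ((pushforward f).obj ((prodOver Y).obj A))).left =
      pullback.fst ((pushforward f).obj ((prodOver Y).obj A)).hom v := e
  rw [← e']
  rfl

lemma cartesianApp_hom {Y' Y B' B : E} {u : Y' ⟶ Y} {f' : Y' ⟶ B'} {f : Y ⟶ B}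
    {v : B' ⟶ B} (sq : IsPullback u f' f v) [Exponentiable f] [Exponentiable f'] (A : E) :
    cartesianApp sq A ≫ ((pushforward f).obj ((prodOver Y).obj A)).hom =
      ((pushforward f').obj ((prodOver Y').obj A)).hom ≫ v := by
  have w : ((pushforward f').map ((prodOverPullback u).app A)).left ≫
      ((pushforward f').obj ((Over.pullback u).obj ((prodOver Y).obj A))).hom =
    ((pushforward f').obj ((prodOver Y').obj A)).hom := Over.w _
  rw [cartesianApp_eq, Category.assoc, beckChevalley_comp_fst_hom, ← Category.assoc, w]

lemma evalAt_cartesianApp {Y' Y B' B : E} {u : Y' ⟶ Y} {f' : Y' ⟶ B'} {f : Y ⟶ B}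
    {v : B' ⟶ B} (sq : IsPullback u f' f v) [Exponentiable f] [Exponentiable f'] (A : E)
    {T : E} (x : T ⟶ ((pushforward f').obj ((prodOver Y').obj A)).left) (d : T ⟶ Y')
    (h : x ≫ ((pushforward f').obj ((prodOver Y').obj A)).hom = d ≫ f')
    (h' : (x ≫ cartesianApp sq A) ≫ ((pushforward f).obj ((prodOver Y).obj A)).hom =
      (d ≫ u) ≫ f) :
    evalAt f ((prodOver Y).obj A) (x ≫ cartesianApp sq A) (d ≫ u) h' =
      evalAt f' ((prodOver Y').obj A) x d h ≫ prod.map (𝟙 A) u := by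
  have w : ((pushforward f').map ((prodOverPullback u).app A)).left ≫
      ((pushforward f').obj ((Over.pullback u).obj ((prodOver Y).obj A))).hom =
    ((pushforward f').obj ((prodOver Y').obj A)).hom := Over.w _
  have h1 : (x ≫ ((pushforward f').map ((prodOverPullback u).app A)).left) ≫
      ((pushforward f').obj ((Over.pullback u).obj ((prodOver Y).obj A))).hom = d ≫ f' := by
    rw [Category.assoc, w, h]
  have e1 := evalAt_beckChevalley sq ((prodOver Y).obj A)
    (x ≫ ((pushforward f').map ((prodOverPullback u).app A)).left) d h1
    (by rw [← h', cartesianApp_eq]; simp only [Category.assoc])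
  have e2 := evalAt_map f' ((prodOverPullback u).app A) x d h h1
  have e3 : x ≫ cartesianApp sq A =
      (x ≫ ((pushforward f').map ((prodOverPullback u).app A)).left) ≫
        ((beckChevalley sq).app ((prodOver Y).obj A)).left ≫
          pullback.fst ((pushforward f).obj ((prodOver Y).obj A)).hom v := by
    rw [cartesianApp_eq]; simp only [Category.assoc]
  have e4 : evalAt f ((prodOver Y).obj A) (x ≫ cartesianApp sq A) (d ≫ u) h' =
      evalAt f ((prodOver Y).obj A) ((x ≫ ((pushforward f').map
        ((prodOverPullback u).app A)).left) ≫ ((beckChevalley sq).app ((prodOver Y).obj A)).left ≫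
          pullback.fst ((pushforward f).obj ((prodOver Y).obj A)).hom v) (d ≫ u)
          (by rw [← e3, h']) := by
    congr 1
  rw [e4, e1]
  have key (ev : T ⟶ A ⨯ Y') : (ev ≫ (pullback.lift (prod.map (𝟙 A) u) prod.snd (by simp) :
      A ⨯ Y' ⟶ pullback (prod.snd : A ⨯ Y ⟶ Y) u)) ≫ pullback.fst _ _ =
      ev ≫ prod.map (𝟙 A) u := by simp
  exact (congrArg (fun k : T ⟶ pullback (prod.snd : A ⨯ Y ⟶ Y) u => k ≫ pullback.fst _ _) e2).trans
    (key _)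

variable (E) in
/-- A polynomial in `E` is an exponentiable morphism of `E`. -/
structure Poly where
  /-- The object of positions. -/
  base : E
  /-- The object of directions. -/
  total : E
  /-- The morphism from directions to positions. -/
  hom : total ⟶ base
  /-- It is exponentiable. -/
  exp : Exponentiable hom

attribute [instance] Poly.exp

namespace Poly

/-- A morphism of polynomials from `p` to `q`: a morphism on positions, together with a
morphism on directions defined on the pullback and lying over the positions of `p`. An
isomorphism class of such data over varying choices of the pullback contains exactly one
representative over the chosen pullback. -/
@[ext]
structure Hom (p q : Poly E) where
  /-- The component on positions. -/
  onBase : p.base ⟶ q.base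
  /-- The component on directions. -/
  onTotal : pullback onBase q.hom ⟶ p.total
  /-- The component on directions is a morphism over the positions of `p`. -/
  onTotal_hom : onTotal ≫ p.hom = pullback.fst onBase q.hom

/-- The action of a morphism of polynomials on generalized directions. -/
def Hom.app {p q : Poly E} (φ : Hom p q) {T : E} (x : T ⟶ p.base) (d : T ⟶ q.total)
    (h : x ≫ φ.onBase = d ≫ q.hom) : T ⟶ p.total :=
  pullback.lift x d h ≫ φ.onTotal

lemma Hom.app_hom {p q : Poly E} (φ : Hom p q) {T : E} (x : T ⟶ p.base) (d : T ⟶ q.total)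
    (h : x ≫ φ.onBase = d ≫ q.hom) : φ.app x d h ≫ p.hom = x := by
  rw [Hom.app, Category.assoc, φ.onTotal_hom, pullback.lift_fst]

lemma Hom.comp_app {p q : Poly E} (φ : Hom p q) {S T : E} (a : S ⟶ T) (x : T ⟶ p.base)
    (d : T ⟶ q.total) (h : x ≫ φ.onBase = d ≫ q.hom) :
    a ≫ φ.app x d h = φ.app (a ≫ x) (a ≫ d) (by simp [h]) := by
  rw [Hom.app, Hom.app, ← Category.assoc]
  congr 1
  apply pullback.hom_ext <;> simp

lemma Hom.ext_app {p q : Poly E} {φ ψ : Hom p q} (h : φ.onBase = ψ.onBase)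
    (H : ∀ (T : E) (x : T ⟶ p.base) (d : T ⟶ q.total) (h₁ : x ≫ φ.onBase = d ≫ q.hom)
      (h₂ : x ≫ ψ.onBase = d ≫ q.hom), φ.app x d h₁ = ψ.app x d h₂) : φ = ψ := by
  obtain ⟨f, g, w⟩ := φ
  obtain ⟨f', g', w'⟩ := ψ
  obtain rfl : f = f' := h
  have := H _ (pullback.fst f q.hom) (pullback.snd f q.hom) pullback.condition pullback.condition
  simp only [Hom.app, pullback.lift_fst_snd, Category.id_comp] at this
  subst this
  rfl

/-- The identity morphism of a polynomial. -/
def Hom.id (p : Poly E) : Hom p p where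
  onBase := 𝟙 p.base
  onTotal := pullback.snd (𝟙 p.base) p.hom
  onTotal_hom := by rw [← pullback.condition, Category.comp_id]

/-- The composite of two morphisms of polynomials: on positions the composite, on directions
`P ×_R R_* ≅ P ×_Q (Q ×_R R_*) ⟶ P ×_Q Q_* ⟶ P_*`. -/
def Hom.comp {p q r : Poly E} (φ : Hom p q) (ψ : Hom q r) : Hom p r where
  onBase := φ.onBase ≫ ψ.onBase
  onTotal := φ.app (pullback.fst (φ.onBase ≫ ψ.onBase) r.hom)
    (ψ.app (pullback.fst (φ.onBase ≫ ψ.onBase) r.hom ≫ φ.onBase)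
      (pullback.snd (φ.onBase ≫ ψ.onBase) r.hom) (by rw [Category.assoc, pullback.condition]))
    (by rw [Hom.app_hom])
  onTotal_hom := by rw [Hom.app_hom]

lemma Hom.id_app (p : Poly E) {T : E} (x : T ⟶ p.base) (d : T ⟶ p.total)
    (h : x ≫ (Hom.id p).onBase = d ≫ p.hom) : (Hom.id p).app x d h = d :=
  pullback.lift_snd _ _ _

lemma Hom.comp_app_eq {p q r : Poly E} (φ : Hom p q) (ψ : Hom q r) {T : E} (x : T ⟶ p.base)
    (d : T ⟶ r.total) (h : x ≫ (φ.comp ψ).onBase = d ≫ r.hom) :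
    (φ.comp ψ).app x d h = φ.app x (ψ.app (x ≫ φ.onBase) d (by rw [Category.assoc]; exact h))
      (by rw [Hom.app_hom]) := by
  have h0 : x ≫ φ.onBase ≫ ψ.onBase = d ≫ r.hom := h
  change pullback.lift x d h0 ≫ φ.app _ _ _ = _
  rw [Hom.comp_app]
  congr 1
  · simp
  · rw [Hom.comp_app]
    congr 1 <;> simp

instance : Category (Poly E) where
  Hom := Hom
  id := Hom.id
  comp := Hom.comp
  id_comp φ := by
    refine Hom.ext_app (Category.id_comp _) fun T x d h₁ h₂ => ?_
    rw [Hom.comp_app_eq, Hom.id_app]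
    congr 1
    exact Category.comp_id x
  comp_id φ := by
    refine Hom.ext_app (Category.comp_id _) fun T x d h₁ h₂ => ?_
    rw [Hom.comp_app_eq]
    congr 1
    exact Hom.id_app _ _ _ _
  assoc φ ψ χ := by
    refine Hom.ext_app (Category.assoc _ _ _) fun T x d h₁ h₂ => ?_
    rw [Hom.comp_app_eq, Hom.comp_app_eq, Hom.comp_app_eq]
    congr 1
    refine Eq.trans ?_ (Hom.comp_app_eq _ _ _ _ _).symm
    congr 2
    exact (Category.assoc _ _ _).symm

@[simp] lemma id_onBase (p : Poly E) : Hom.onBase (𝟙 p) = 𝟙 p.base := rfl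

@[simp] lemma comp_onBase {p q r : Poly E} (φ : p ⟶ q) (ψ : q ⟶ r) :
    Hom.onBase (φ ≫ ψ) = Hom.onBase φ ≫ Hom.onBase ψ := rfl

/-- The polynomial endofunctor `Σ_! Π_p Δ_!` of a polynomial. -/
def functor (p : Poly E) : E ⥤ E :=
  prodOver p.total ⋙ pushforward p.hom ⋙ Over.forget p.base

/-- The projection of the polynomial functor to the object of positions. -/
def proj (p : Poly E) (A : E) : p.functor.obj A ⟶ p.base :=
  ((pushforward p.hom).obj ((prodOver p.total).obj A)).hom

/-- Evaluation of a generalized element of `p(A)` at a direction. -/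
def evAt (p : Poly E) {A T : E} (x : T ⟶ p.functor.obj A) (d : T ⟶ p.total)
    (h : x ≫ p.proj A = d ≫ p.hom) : T ⟶ A :=
  evalAt p.hom ((prodOver p.total).obj A) x d h ≫ (prod.fst : A ⨯ p.total ⟶ A)

lemma evalAt_eq (p : Poly E) {A T : E} (x : T ⟶ p.functor.obj A) (d : T ⟶ p.total)
    (h : x ≫ p.proj A = d ≫ p.hom) :
    (evalAt p.hom ((prodOver p.total).obj A) x d h : T ⟶ A ⨯ p.total) =
      prod.lift (p.evAt x d h) d := by
  apply prod.hom_ext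
  · rw [prod.lift_fst]; rfl
  · rw [prod.lift_snd]; exact evalAt_hom p.hom ((prodOver p.total).obj A) x d h

lemma comp_evAt (p : Poly E) {A S T : E} (a : S ⟶ T) (x : T ⟶ p.functor.obj A)
    (d : T ⟶ p.total) (h : x ≫ p.proj A = d ≫ p.hom) :
    a ≫ p.evAt x d h = p.evAt (a ≫ x) (a ≫ d) (by simp [h]) := by
  have key {V W : E} (ev : T ⟶ V) (ev' : S ⟶ V) (k : V ⟶ W) (e : a ≫ ev = ev') :
      a ≫ ev ≫ k = ev' ≫ k := by rw [← e, Category.assoc]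
  exact key _ _ _ (comp_evalAt p.hom ((prodOver p.total).obj A) a x d h)

lemma map_proj (p : Poly E) {A B : E} (k : A ⟶ B) :
    p.functor.map k ≫ p.proj B = p.proj A :=
  Over.w ((pushforward p.hom).map ((prodOver p.total).map k))

lemma evAt_map (p : Poly E) {A B T : E} (k : A ⟶ B) (x : T ⟶ p.functor.obj A)
    (d : T ⟶ p.total) (h : x ≫ p.proj A = d ≫ p.hom)
    (h' : (x ≫ p.functor.map k) ≫ p.proj B = d ≫ p.hom) :
    p.evAt (x ≫ p.functor.map k) d h' = p.evAt x d h ≫ k := by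
  have e := evalAt_map p.hom ((prodOver p.total).map k) x d h h'
  refine (congrArg (fun k : T ⟶ B ⨯ p.total => k ≫ prod.fst) e).trans ?_
  have key (ev : T ⟶ A ⨯ p.total) :
      (ev ≫ prod.map k (𝟙 _)) ≫ prod.fst = (ev ≫ prod.fst) ≫ k := by simp
  exact key _

/-- Generalized elements of `p(A)` with the same position agree as soon as they agree at all
directions. -/
lemma functor_hom_ext (p : Poly E) {A T : E} (x y : T ⟶ p.functor.obj A)
    (h : x ≫ p.proj A = y ≫ p.proj A)
    (H : ∀ (S : E) (a : S ⟶ T) (d : S ⟶ p.total) (hx : (a ≫ x) ≫ p.proj A = d ≫ p.hom)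
      (hy : (a ≫ y) ≫ p.proj A = d ≫ p.hom), p.evAt (a ≫ x) d hx = p.evAt (a ≫ y) d hy) :
    x = y := by
  refine pushforward_hom_ext p.hom x y h fun S a d hx hy => ?_
  refine (evalAt_eq p (a ≫ x) d hx).trans (Eq.trans ?_ (evalAt_eq p (a ≫ y) d hy).symm)
  rw [H S a d hx hy]

/-- The morphism to `p(A)` determined by a morphism `f` to positions and a morphism to `A` defined
on the pullback of `p` along `f`. -/
def lift (p : Poly E) {A T : E} (f : T ⟶ p.base) (g : pullback f p.hom ⟶ A) :
    T ⟶ p.functor.obj A :=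
  ((pushAdj p.hom).homEquiv (Over.mk f) ((prodOver p.total).obj A)
    (Over.homMk (show pullback f p.hom ⟶ A ⨯ p.total from prod.lift g (pullback.snd f p.hom))
      (prod.lift_snd _ _))).left

lemma lift_proj (p : Poly E) {A T : E} (f : T ⟶ p.base) (g : pullback f p.hom ⟶ A) :
    p.lift f g ≫ p.proj A = f :=
  Over.w ((pushAdj p.hom).homEquiv (Over.mk f) ((prodOver p.total).obj A) _)

lemma evAt_lift (p : Poly E) {A T S : E} (f : T ⟶ p.base) (g : pullback f p.hom ⟶ A)
    (a : S ⟶ T) (d : S ⟶ p.total) (h : (a ≫ p.lift f g) ≫ p.proj A = d ≫ p.hom) :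
    p.evAt (a ≫ p.lift f g) d h =
      pullback.lift a d (by rwa [Category.assoc, lift_proj] at h) ≫ g := by
  have e := evalAt_homEquiv p.hom _ _ rfl (X := Over.mk f) (Z := (prodOver p.total).obj A) a d
    (by rw [Category.assoc, lift_proj] at h; exact h) h
  refine (congrArg (fun k : S ⟶ A ⨯ p.total => k ≫ prod.fst) e).trans ?_
  have key (b : S ⟶ pullback f p.hom) :
      (b ≫ prod.lift g (pullback.snd f p.hom)) ≫ prod.fst = b ≫ g := by simp
  exact key _

instance (p q : Poly E) (φ : Hom p q) : Exponentiable (φ.onTotal ≫ p.hom) := by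
  rw [φ.onTotal_hom]; infer_instance

lemma Hom.isPullback {p q : Poly E} (φ : Hom p q) :
    IsPullback (pullback.snd φ.onBase q.hom) (φ.onTotal ≫ p.hom) q.hom φ.onBase := by
  rw [φ.onTotal_hom]; exact (IsPullback.of_hasPullback _ _).flip

/-- The natural transformation of polynomial functors induced by a morphism `φ` of polynomials:
the one of its vertical part, from `p` to the pullback of `q` along `φ₁`, followed by the one of
its cartesian part, from that pullback to `q`. -/
def trans {p q : Poly E} (φ : p ⟶ q) : p.functor ⟶ q.functor :=
  Functor.whiskerRight (verticalTrans (Hom.onTotal φ) p.hom) (Over.forget p.base) ≫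
    cartesianTrans (Hom.isPullback φ)

lemma trans_proj {p q : Poly E} (φ : p ⟶ q) (A : E) :
    (trans φ).app A ≫ q.proj A = p.proj A ≫ Hom.onBase φ := by
  have h1 := cartesianApp_hom (Hom.isPullback φ) A
  have h2 := Over.w ((verticalTrans (Hom.onTotal φ) p.hom).app A)
  have key {X Y Z P Q : E} (a : X ⟶ Y) (b : Y ⟶ Z) (pz : Z ⟶ Q) (py : Y ⟶ P) (px : X ⟶ P)
      (f : P ⟶ Q) (h1 : b ≫ pz = py ≫ f) (h2 : a ≫ py = px) : (a ≫ b) ≫ pz = px ≫ f := by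
    rw [Category.assoc, h1, ← Category.assoc, h2]
  exact key _ _ _ _ _ _ h1 h2

lemma evAt_trans {p q : Poly E} (φ : p ⟶ q) {A T : E} (x : T ⟶ p.functor.obj A)
    (d : T ⟶ q.total) (h : (x ≫ (trans φ).app A) ≫ q.proj A = d ≫ q.hom)
    (h' : (x ≫ p.proj A) ≫ Hom.onBase φ = d ≫ q.hom) :
    q.evAt (x ≫ (trans φ).app A) d h =
      p.evAt x (Hom.app φ (x ≫ p.proj A) d h') (by rw [Hom.app_hom]) := by
  let w := Hom.onTotal φ
  let y : T ⟶ ((pushforward (w ≫ p.hom)).obj ((prodOver _).obj A)).left :=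
    x ≫ ((verticalTrans w p.hom).app A).left
  let d' : T ⟶ pullback (Hom.onBase φ) q.hom := pullback.lift (x ≫ p.proj A) d h'
  have hd : d' ≫ pullback.snd (Hom.onBase φ) q.hom = d := pullback.lift_snd _ _ _
  have hw : d' ≫ w ≫ p.hom = x ≫ p.proj A :=
    (Category.assoc _ _ _).symm.trans (Hom.app_hom φ _ _ h')
  have hy : y ≫ ((pushforward (w ≫ p.hom)).obj ((prodOver _).obj A)).hom = d' ≫ w ≫ p.hom := by
    rw [hw]
    have := Over.w ((verticalTrans w p.hom).app A)
    exact (Category.assoc _ _ _).trans (congrArg (fun k => x ≫ k) this)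
  have e0 : x ≫ (trans φ).app A = y ≫ cartesianApp (Hom.isPullback φ) A :=
    (Category.assoc _ _ _).symm
  have h1 : (y ≫ cartesianApp (Hom.isPullback φ) A) ≫ q.proj A =
      (d' ≫ pullback.snd (Hom.onBase φ) q.hom) ≫ q.hom := by
    rw [hd, ← h, e0]; rfl
  have e1 := evalAt_cartesianApp (Hom.isPullback φ) A y d' hy h1
  have e2 := evalAt_verticalTrans w p.hom A x d' hw.symm hy
  have e3 : q.evAt (x ≫ (trans φ).app A) d h =
      q.evAt (y ≫ cartesianApp (Hom.isPullback φ) A)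
        (d' ≫ pullback.snd (Hom.onBase φ) q.hom) h1 := by
    congr 1
    exact hd.symm
  have key {U V : E} (a : T ⟶ A ⨯ V) (b : T ⟶ A ⨯ U) (t : T ⟶ A ⨯ p.total) (u : U ⟶ V)
      (k : T ⟶ U) (e1 : a = b ≫ prod.map (𝟙 A) u)
      (e2 : b = prod.lift (t ≫ prod.fst) k) : a ≫ prod.fst = t ≫ prod.fst := by
    rw [e1, e2]; simp
  exact e3.trans (key _ _ _ _ _ e1 e2)

lemma trans_id (p : Poly E) : trans (𝟙 p) = 𝟙 p.functor := by
  ext A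
  refine functor_hom_ext p _ _ ?_ fun S a d hx hy => ?_
  · rw [trans_proj]
    exact (Category.comp_id _).trans (Category.id_comp _).symm
  · rw [evAt_trans (𝟙 p) a d hx (by rw [← hx, Category.assoc, Category.assoc, trans_proj])]
    have e : a ≫ (𝟙 p.functor : p.functor ⟶ p.functor).app A = a := Category.comp_id a
    simp only [e]
    congr 1
    exact Hom.id_app _ _ _ _

lemma trans_comp {p q r : Poly E} (φ : p ⟶ q) (ψ : q ⟶ r) :
    trans (φ ≫ ψ) = trans φ ≫ trans ψ := by
  ext A
  refine functor_hom_ext r _ _ ?_ fun S a d hx hy => ?_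
  · rw [trans_proj, NatTrans.comp_app, Category.assoc, trans_proj, ← Category.assoc, trans_proj,
      Category.assoc]
    rfl
  · have h1 : (a ≫ p.proj A) ≫ Hom.onBase (φ ≫ ψ) = d ≫ r.hom := by
      rw [← hx, Category.assoc, Category.assoc, trans_proj]
    have h2 : ((a ≫ (trans φ).app A) ≫ q.proj A) ≫ Hom.onBase ψ = d ≫ r.hom := by
      rw [← h1, Category.assoc a, trans_proj]; simp
    have h3 : (a ≫ p.proj A) ≫ Hom.onBase φ =
        Hom.app ψ ((a ≫ (trans φ).app A) ≫ q.proj A) d h2 ≫ q.hom := by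
      rw [Hom.app_hom, Category.assoc, Category.assoc, trans_proj]
    have h4 : ((a ≫ (trans φ).app A) ≫ (trans ψ).app A) ≫ r.proj A = d ≫ r.hom := by
      rw [← hy]; simp
    rw [evAt_trans (φ ≫ ψ) a d hx h1]
    have e : a ≫ (trans φ ≫ trans ψ).app A = (a ≫ (trans φ).app A) ≫ (trans ψ).app A := by simp
    simp only [e]
    rw [evAt_trans ψ (a ≫ (trans φ).app A) d h4 h2, evAt_trans φ a _ _ h3]
    congr 1
    refine (Hom.comp_app_eq φ ψ _ _ _).trans ?_
    congr 2
    rw [Category.assoc, Category.assoc, trans_proj]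

/-- The evaluation `p(A) ×_P P_* ⟶ A`. -/
def ev (p : Poly E) (A : E) : pullback (p.proj A) p.hom ⟶ A :=
  evMap p.hom ((prodOver p.total).obj A) ≫ (prod.fst : A ⨯ p.total ⟶ A)

lemma evAt_eq_lift_ev (p : Poly E) {A T : E} (x : T ⟶ p.functor.obj A) (d : T ⟶ p.total)
    (h : x ≫ p.proj A = d ≫ p.hom) : p.evAt x d h = pullback.lift x d h ≫ p.ev A :=
  Category.assoc _ _ _

variable (E) in
/-- The identity polynomial: the identity of the terminal object. -/
def y : Poly E where
  base := ⊤_ E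
  total := ⊤_ E
  hom := 𝟙 (⊤_ E)
  exp := exponentiable_id _

/-- The composition product: the object of positions is `Π_p (Q × P_*) = p(Q)`, and the object
of directions is the pullback of `q` along `Π_p (Q × P_*) ×_P P_* ⟶ Q × P_* ⟶ Q`. -/
def tri (p q : Poly E) : Poly E where
  base := p.functor.obj q.base
  total := pullback (p.ev q.base) q.hom
  hom := pullback.fst (p.ev q.base) q.hom ≫ pullback.fst (p.proj q.base) p.hom
  exp := exponentiable_comp _ _

/-- The strength of a polynomial functor: the morphism `A × p(B) ⟶ p(A × B)` which keeps the
position and sends a direction to the pair of the given element of `A` and the value in `B`. -/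
def strength (p : Poly E) (A B : E) : A ⨯ p.functor.obj B ⟶ p.functor.obj (A ⨯ B) :=
  p.lift (prod.snd ≫ p.proj B)
    (prod.lift (pullback.fst _ _ ≫ prod.fst)
      (p.evAt (pullback.fst _ _ ≫ prod.snd) (pullback.snd _ _)
        (by rw [Category.assoc, pullback.condition])))

lemma strength_proj (p : Poly E) (A B : E) :
    p.strength A B ≫ p.proj (A ⨯ B) = prod.snd ≫ p.proj B :=
  lift_proj _ _ _

lemma evAt_strength (p : Poly E) {A B T : E} (x : T ⟶ A ⨯ p.functor.obj B)
    (d : T ⟶ p.total) (h : (x ≫ p.strength A B) ≫ p.proj (A ⨯ B) = d ≫ p.hom)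
    (h' : (x ≫ prod.snd) ≫ p.proj B = d ≫ p.hom) :
    p.evAt (x ≫ p.strength A B) d h = prod.lift (x ≫ prod.fst) (p.evAt (x ≫ prod.snd) d h') := by
  refine (evAt_lift p _ _ x d h).trans ?_
  rw [prod.comp_lift, comp_evAt]
  congr 1
  · simp
  · congr 1 <;> simp

end Poly

variable (E) in
/-- An endofunctor of `E` equipped with a strength. -/
structure StrongEndofunctor where
  /-- The underlying endofunctor. -/
  functor : E ⥤ E
  /-- The strength. -/
  strength (A B : E) : A ⨯ functor.obj B ⟶ functor.obj (A ⨯ B)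
  strength_natural {A A' B B' : E} (f : A ⟶ A') (g : B ⟶ B') :
    prod.map f (functor.map g) ≫ strength A' B' = strength A B ≫ functor.map (prod.map f g)
  strength_unit (B : E) :
    strength (⊤_ E) B ≫ functor.map (prod.leftUnitor B).hom =
      (prod.leftUnitor (functor.obj B)).hom
  strength_assoc (A A' B : E) :
    strength (A ⨯ A') B ≫ functor.map (prod.associator A A' B).hom =
      (prod.associator A A' (functor.obj B)).hom ≫
        prod.map (𝟙 A) (strength A' B) ≫ strength A (A' ⨯ B)

namespace StrongEndofunctor

/-- A strong natural transformation. -/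
@[ext]
structure Hom (F G : StrongEndofunctor E) where
  /-- The underlying natural transformation. -/
  natTrans : F.functor ⟶ G.functor
  strong (A B : E) :
    prod.map (𝟙 A) (natTrans.app B) ≫ G.strength A B =
      F.strength A B ≫ natTrans.app (A ⨯ B)

instance : Category (StrongEndofunctor E) where
  Hom := Hom
  id F := ⟨𝟙 F.functor, fun A B => by simp⟩
  comp α β := ⟨α.natTrans ≫ β.natTrans, fun A B => by
    rw [NatTrans.comp_app, NatTrans.comp_app, prod.map_id_comp, Category.assoc, β.strong,
      ← Category.assoc, α.strong, Category.assoc]⟩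
  id_comp α := Hom.ext (Category.id_comp _)
  comp_id α := Hom.ext (Category.comp_id _)
  assoc α β γ := Hom.ext (Category.assoc _ _ _)

@[ext]
lemma hom_ext {F G : StrongEndofunctor E} {α β : F ⟶ G}
    (h : ∀ A, (Hom.natTrans α).app A = (Hom.natTrans β).app A) : α = β :=
  Hom.ext (NatTrans.ext (funext h))

@[simp] lemma id_natTrans (F : StrongEndofunctor E) : Hom.natTrans (𝟙 F) = 𝟙 F.functor := rfl

@[simp] lemma comp_natTrans {F G H : StrongEndofunctor E} (α : F ⟶ G) (β : G ⟶ H) :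
    Hom.natTrans (α ≫ β) = Hom.natTrans α ≫ Hom.natTrans β := rfl

/-- The composite `A ↦ F (G A)` of strong endofunctors. -/
def comp (F G : StrongEndofunctor E) : StrongEndofunctor E where
  functor := G.functor ⋙ F.functor
  strength A B := F.strength A (G.functor.obj B) ≫ F.functor.map (G.strength A B)
  strength_natural f g := by
    have h1 := F.strength_natural f (G.functor.map g)
    have h2 := congrArg F.functor.map (G.strength_natural f g)
    rw [Functor.map_comp, Functor.map_comp] at h2
    dsimp
    rw [← Category.assoc, h1, Category.assoc, h2, Category.assoc]
  strength_unit B := by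
    have h1 := congrArg F.functor.map (G.strength_unit B)
    rw [Functor.map_comp] at h1
    have h2 := F.strength_unit (G.functor.obj B)
    dsimp at h1 h2 ⊢
    rw [Category.assoc, h1, h2]
  strength_assoc A A' B := by
    have h1 := congrArg F.functor.map (G.strength_assoc A A' B)
    have h2 := F.strength_assoc A A' (G.functor.obj B)
    have h3 := F.strength_natural (𝟙 A) (G.strength A' B)
    simp only [Functor.map_comp] at h1
    change (F.strength (A ⨯ A') (G.functor.obj B) ≫ F.functor.map (G.strength (A ⨯ A') B)) ≫
      F.functor.map (G.functor.map (prod.associator A A' B).hom) =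
      (prod.associator A A' (F.functor.obj (G.functor.obj B))).hom ≫
        prod.map (𝟙 A) (F.strength A' (G.functor.obj B) ≫ F.functor.map (G.strength A' B)) ≫
          F.strength A (G.functor.obj (A' ⨯ B)) ≫ F.functor.map (G.strength A (A' ⨯ B))
    rw [Category.assoc, h1, ← Category.assoc, h2, prod.map_id_comp]
    simp only [Category.assoc]
    rw [← Category.assoc (prod.map (𝟙 A) (F.functor.map _)), h3, Category.assoc]

/-- The identity functor with its canonical strength. -/
def unit : StrongEndofunctor E where
  functor := 𝟭 E
  strength A B := 𝟙 (A ⨯ B)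
  strength_natural f g := (Category.comp_id _).trans (Category.id_comp _).symm
  strength_unit B := Category.id_comp _
  strength_assoc A A' B := by
    change 𝟙 _ ≫ (prod.associator A A' B).hom = (prod.associator A A' B).hom ≫
      prod.map (𝟙 A) (𝟙 (A' ⨯ B)) ≫ 𝟙 _
    simp

/-- Strong natural isomorphisms from strong natural transformations which are mutually inverse. -/
def isoOfApp {F G : StrongEndofunctor E} (α : F ⟶ G) (β : G ⟶ F)
    (h₁ : ∀ A, (Hom.natTrans α).app A ≫ (Hom.natTrans β).app A = 𝟙 _)
    (h₂ : ∀ A, (Hom.natTrans β).app A ≫ (Hom.natTrans α).app A = 𝟙 _) : F ≅ G where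
  hom := α
  inv := β
  hom_inv_id := hom_ext h₁
  inv_hom_id := hom_ext h₂

/-- The associator of composition. -/
def assocHom (F G H : StrongEndofunctor E) : ((F.comp G).comp H) ⟶ (F.comp (G.comp H)) where
  natTrans :=
    { app := fun A => 𝟙 (F.functor.obj (G.functor.obj (H.functor.obj A)))
      naturality := fun _ _ _ => (Category.comp_id _).trans (Category.id_comp _).symm }
  strong A B := by
    change prod.map (𝟙 A) (𝟙 (F.functor.obj (G.functor.obj (H.functor.obj B)))) ≫ F.strength A (G.functor.obj (H.functor.obj B)) ≫
            F.functor.map (G.strength A (H.functor.obj B) ≫ G.functor.map (H.strength A B)) =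
      ((F.strength A (G.functor.obj (H.functor.obj B)) ≫ F.functor.map (G.strength A (H.functor.obj B))) ≫
            F.functor.map (G.functor.map (H.strength A B))) ≫ 𝟙 (F.functor.obj (G.functor.obj (H.functor.obj (A ⨯ B))))
    simp

/-- The inverse associator of composition. -/
def assocInv (F G H : StrongEndofunctor E) : (F.comp (G.comp H)) ⟶ ((F.comp G).comp H) where
  natTrans :=
    { app := fun A => 𝟙 (F.functor.obj (G.functor.obj (H.functor.obj A)))
      naturality := fun _ _ _ => (Category.comp_id _).trans (Category.id_comp _).symm }
  strong A B := by
    change prod.map (𝟙 A) (𝟙 (F.functor.obj (G.functor.obj (H.functor.obj B)))) ≫ (F.strength A (G.functor.obj (H.functor.obj B)) ≫ F.functor.map (G.strength A (H.functor.obj B))) ≫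
            F.functor.map (G.functor.map (H.strength A B)) =
      (F.strength A (G.functor.obj (H.functor.obj B)) ≫
            F.functor.map (G.strength A (H.functor.obj B) ≫ G.functor.map (H.strength A B))) ≫ 𝟙 (F.functor.obj (G.functor.obj (H.functor.obj (A ⨯ B))))
    simp

/-- The left unitor of composition. -/
def leftUnitHom (F : StrongEndofunctor E) : unit.comp F ⟶ F where
  natTrans :=
    { app := fun A => 𝟙 (F.functor.obj A)
      naturality := fun _ _ _ => (Category.comp_id _).trans (Category.id_comp _).symm }
  strong A B := by
    change prod.map (𝟙 A) (𝟙 (F.functor.obj B)) ≫ F.strength A B =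
      (𝟙 (A ⨯ F.functor.obj B) ≫ F.strength A B) ≫ 𝟙 (F.functor.obj (A ⨯ B))
    simp

/-- The inverse left unitor of composition. -/
def leftUnitInv (F : StrongEndofunctor E) : F ⟶ unit.comp F where
  natTrans :=
    { app := fun A => 𝟙 (F.functor.obj A)
      naturality := fun _ _ _ => (Category.comp_id _).trans (Category.id_comp _).symm }
  strong A B := by
    change prod.map (𝟙 A) (𝟙 (F.functor.obj B)) ≫ 𝟙 (A ⨯ F.functor.obj B) ≫ F.strength A B =
      (F.strength A B) ≫ 𝟙 (F.functor.obj (A ⨯ B))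
    simp

/-- The right unitor of composition. -/
def rightUnitHom (F : StrongEndofunctor E) : F.comp unit ⟶ F where
  natTrans :=
    { app := fun A => 𝟙 (F.functor.obj A)
      naturality := fun _ _ _ => (Category.comp_id _).trans (Category.id_comp _).symm }
  strong A B := by
    change prod.map (𝟙 A) (𝟙 (F.functor.obj B)) ≫ F.strength A B =
      (F.strength A B ≫ F.functor.map (𝟙 (A ⨯ B))) ≫ 𝟙 (F.functor.obj (A ⨯ B))
    simp

/-- The inverse right unitor of composition. -/
def rightUnitInv (F : StrongEndofunctor E) : F ⟶ F.comp unit where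
  natTrans :=
    { app := fun A => 𝟙 (F.functor.obj A)
      naturality := fun _ _ _ => (Category.comp_id _).trans (Category.id_comp _).symm }
  strong A B := by
    change prod.map (𝟙 A) (𝟙 (F.functor.obj B)) ≫ F.strength A B ≫ F.functor.map (𝟙 (A ⨯ B)) =
      (F.strength A B) ≫ 𝟙 (F.functor.obj (A ⨯ B))
    simp

/-- Strong endofunctors form a monoidal category under composition, the product of `F` and `G`
being `A ↦ F (G A)`. -/
instance : MonoidalCategory (StrongEndofunctor E) where
  tensorObj F G := F.comp G
  tensorUnit := unit
  whiskerLeft F {G G'} β :=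
    { natTrans := Functor.whiskerRight (Hom.natTrans β) F.functor
      strong := fun A B => by
        have h1 := F.strength_natural (𝟙 A) ((Hom.natTrans β).app B)
        have h2 := congrArg F.functor.map (Hom.strong β A B)
        rw [Functor.map_comp, Functor.map_comp] at h2
        change prod.map (𝟙 A) (F.functor.map ((Hom.natTrans β).app B)) ≫
            F.strength A (G'.functor.obj B) ≫ F.functor.map (G'.strength A B) =
          (F.strength A (G.functor.obj B) ≫ F.functor.map (G.strength A B)) ≫
            F.functor.map ((Hom.natTrans β).app (A ⨯ B))
        rw [← Category.assoc, h1, Category.assoc, h2, Category.assoc] }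
  whiskerRight {F F'} α G :=
    { natTrans := Functor.whiskerLeft G.functor (Hom.natTrans α)
      strong := fun A B => by
        have h1 := Hom.strong α A (G.functor.obj B)
        have h2 := (Hom.natTrans α).naturality (G.strength A B)
        change prod.map (𝟙 A) ((Hom.natTrans α).app (G.functor.obj B)) ≫
            F'.strength A (G.functor.obj B) ≫ F'.functor.map (G.strength A B) =
          (F.strength A (G.functor.obj B) ≫ F.functor.map (G.strength A B)) ≫
            (Hom.natTrans α).app (G.functor.obj (A ⨯ B))
        rw [← Category.assoc, h1, Category.assoc, Category.assoc, h2] }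
  associator F G H := isoOfApp (assocHom F G H) (assocInv F G H)
    (fun A => Category.comp_id _) (fun A => Category.comp_id _)
  leftUnitor F := isoOfApp (leftUnitHom F) (leftUnitInv F)
    (fun A => Category.comp_id _) (fun A => Category.comp_id _)
  rightUnitor F := isoOfApp (rightUnitHom F) (rightUnitInv F)
    (fun A => Category.comp_id _) (fun A => Category.comp_id _)
  tensorHom_def := by intros; rfl
  id_tensorHom_id F G := by
    ext A
    change 𝟙 _ ≫ F.functor.map (𝟙 _) = 𝟙 _
    rw [CategoryTheory.Functor.map_id, Category.comp_id]
  tensorHom_comp_tensorHom {X₁ Y₁ Z₁ X₂ Y₂ Z₂} α β γ δ := by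
    ext A
    change ((Hom.natTrans α).app (X₂.functor.obj A) ≫ Y₁.functor.map ((Hom.natTrans β).app A)) ≫
        (Hom.natTrans γ).app (Y₂.functor.obj A) ≫ Z₁.functor.map ((Hom.natTrans δ).app A) =
      ((Hom.natTrans α).app (X₂.functor.obj A) ≫ (Hom.natTrans γ).app (X₂.functor.obj A)) ≫
        Z₁.functor.map ((Hom.natTrans β).app A ≫ (Hom.natTrans δ).app A)
    simp
  whiskerLeft_id F G := by
    ext A
    exact F.functor.map_id _
  id_whiskerRight F G := by
    ext A
    rfl
  associator_naturality {F₁ F₂ F₃ G₁ G₂ G₃} α β γ := by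
    ext A
    change ((((Hom.natTrans α).app (F₂.functor.obj (F₃.functor.obj A)) ≫
          G₁.functor.map ((Hom.natTrans β).app (F₃.functor.obj A))) ≫
        G₁.functor.map (G₂.functor.map ((Hom.natTrans γ).app A))) ≫
          𝟙 (G₁.functor.obj (G₂.functor.obj (G₃.functor.obj A)))) =
      𝟙 (F₁.functor.obj (F₂.functor.obj (F₃.functor.obj A))) ≫
        ((Hom.natTrans α).app (F₂.functor.obj (F₃.functor.obj A)) ≫
        G₁.functor.map ((Hom.natTrans β).app (F₃.functor.obj A) ≫
          G₂.functor.map ((Hom.natTrans γ).app A)))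
    simp
  leftUnitor_naturality {F G} α := by
    ext A
    exact (Category.comp_id _).trans (Category.id_comp _).symm
  rightUnitor_naturality {F G} α := by
    ext A
    exact (Category.comp_id _).trans (Category.id_comp _).symm
  pentagon F G H K := by
    ext A
    change 𝟙 (F.functor.obj (G.functor.obj (H.functor.obj (K.functor.obj A)))) ≫
      𝟙 (F.functor.obj (G.functor.obj (H.functor.obj (K.functor.obj A)))) ≫
        F.functor.map (𝟙 (G.functor.obj (H.functor.obj (K.functor.obj A)))) = 𝟙 _ ≫ 𝟙 _
    simp
  triangle F G := by
    ext A
    change 𝟙 _ ≫ F.functor.map (𝟙 _) = 𝟙 (F.functor.obj (G.functor.obj A))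
    simp

end StrongEndofunctor

namespace Poly

lemma evAt_congr (p : Poly E) {A T : E} {x x' : T ⟶ p.functor.obj A} {d : T ⟶ p.total}
    (e : x = x') (h : x ≫ p.proj A = d ≫ p.hom) :
    p.evAt x d h = p.evAt x' d (by rw [← e, h]) := by
  subst e; rfl

/-- The polynomial endofunctor of `p` with its strength. -/
def strongFunctor (p : Poly E) : StrongEndofunctor E where
  functor := p.functor
  strength := p.strength
  strength_natural {A A' B B'} f g := by
    refine functor_hom_ext p _ _ ?_ fun S a d hx hy => ?_
    · simp only [Category.assoc, strength_proj, map_proj, prod.map_snd_assoc]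
    · have hp : (a ≫ prod.snd) ≫ p.proj B = d ≫ p.hom := by
        rw [← hy]; simp only [Category.assoc, strength_proj, map_proj]
      have h1 : (a ≫ p.strength A B) ≫ p.proj (A ⨯ B) = d ≫ p.hom := by
        rw [← hp]; simp only [Category.assoc, strength_proj]
      have h2 : ((a ≫ prod.snd) ≫ p.functor.map g) ≫ p.proj B' = d ≫ p.hom := by
        rw [← hp, Category.assoc, map_proj]
      have ex : a ≫ prod.map f (p.functor.map g) ≫ p.strength A' B' =
        (a ≫ prod.map f (p.functor.map g)) ≫ p.strength A' B' := by simp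
      have ey : a ≫ p.strength A B ≫ p.functor.map (prod.map f g) =
        (a ≫ p.strength A B) ≫ p.functor.map (prod.map f g) := by simp
      have e3 : (a ≫ prod.map f (p.functor.map g)) ≫ prod.snd =
        (a ≫ prod.snd) ≫ p.functor.map g := by simp
      rw [evAt_congr p ex hx, evAt_congr p ey hy, evAt_map p _ _ d h1,
        evAt_strength p _ d _ (by rw [e3, h2]), evAt_strength p a d h1 hp,
        evAt_congr p e3, evAt_map p g _ d hp]
      apply prod.hom_ext <;> simp
  strength_unit B := by
    refine functor_hom_ext p _ _ ?_ fun S a d hx hy => ?_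
    · rw [Category.assoc, map_proj, strength_proj]; rfl
    · have hp : (a ≫ prod.snd) ≫ p.proj B = d ≫ p.hom := hy
      have h1 : (a ≫ p.strength _ B) ≫ p.proj _ = d ≫ p.hom := by
        rw [← hp]; simp only [Category.assoc, strength_proj]
      have ex : a ≫ p.strength _ B ≫ p.functor.map (prod.leftUnitor B).hom =
        (a ≫ p.strength _ B) ≫ p.functor.map (prod.leftUnitor B).hom := by simp
      rw [evAt_congr p ex hx, evAt_map p _ _ d h1, evAt_strength p a d h1 hp]
      exact prod.lift_snd _ _
  strength_assoc A A' B := by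
    refine functor_hom_ext p _ _ ?_ fun S a d hx hy => ?_
    · simp only [Category.assoc, strength_proj, map_proj, prod.map_snd_assoc,
        prod.associator_hom, prod.lift_snd_assoc]
    · have hp : (a ≫ prod.snd) ≫ p.proj B = d ≫ p.hom := by
        rw [← hx]; simp only [Category.assoc, strength_proj, map_proj]
      have h1 : (a ≫ p.strength (A ⨯ A') B) ≫ p.proj _ = d ≫ p.hom := by
        rw [← hp]; simp only [Category.assoc, strength_proj]
      have ex : a ≫ p.strength (A ⨯ A') B ≫ p.functor.map (prod.associator A A' B).hom =
        (a ≫ p.strength (A ⨯ A') B) ≫ p.functor.map (prod.associator A A' B).hom := by simp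
      let b : S ⟶ A' ⨯ p.functor.obj B := prod.lift (a ≫ prod.fst ≫ prod.snd) (a ≫ prod.snd)
      let c : S ⟶ A ⨯ p.functor.obj (A' ⨯ B) :=
        prod.lift (a ≫ prod.fst ≫ prod.fst) (b ≫ p.strength A' B)
      have ey : a ≫ (prod.associator A A' (p.functor.obj B)).hom ≫
          prod.map (𝟙 A) (p.strength A' B) ≫ p.strength A (A' ⨯ B) =
          c ≫ p.strength A (A' ⨯ B) := by
        simp only [← Category.assoc]
        congr 1
        apply prod.hom_ext <;> simp [b, c, prod.comp_lift]
      have hb : b ≫ prod.snd = a ≫ prod.snd := prod.lift_snd _ _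
      have hc : c ≫ prod.snd = b ≫ p.strength A' B := prod.lift_snd _ _
      have h2 : (b ≫ prod.snd) ≫ p.proj B = d ≫ p.hom := by rw [hb, hp]
      have h3 : (b ≫ p.strength A' B) ≫ p.proj _ = d ≫ p.hom := by
        rw [Category.assoc, strength_proj, ← Category.assoc, h2]
      have h4 : (c ≫ prod.snd) ≫ p.proj _ = d ≫ p.hom := by rw [hc, h3]
      rw [evAt_congr p ex hx, evAt_congr p ey hy, evAt_map p _ _ d h1,
        evAt_strength p a d h1 hp, evAt_strength p c d _ h4, evAt_congr p hc,
        evAt_strength p b d h3 h2, evAt_congr p hb]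
      apply prod.hom_ext
      · simp [c]
      · apply prod.hom_ext <;> simp [b]

/-- The strong natural transformation of polynomial functors induced by a morphism. -/
def strongTrans {p q : Poly E} (φ : p ⟶ q) : p.strongFunctor ⟶ q.strongFunctor where
  natTrans := trans φ
  strong A B := by
    change prod.map (𝟙 A) ((trans φ).app B) ≫ q.strength A B =
      p.strength A B ≫ (trans φ).app (A ⨯ B)
    refine functor_hom_ext q _ _ ?_ fun S a d hx hy => ?_
    · rw [Category.assoc, Category.assoc, trans_proj, strength_proj, ← Category.assoc,
        ← Category.assoc, strength_proj, prod.map_snd, Category.assoc, trans_proj,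
        Category.assoc]
    · let x := a ≫ (prod.snd : A ⨯ p.functor.obj B ⟶ _)
      have h0 : (x ≫ p.proj B) ≫ Hom.onBase φ = d ≫ q.hom := by
        rw [← hy]; simp only [x, Category.assoc, trans_proj]
        rw [← Category.assoc (p.strength A B), strength_proj, Category.assoc]
      have h1 : (x ≫ (trans φ).app B) ≫ q.proj B = d ≫ q.hom := by
        rw [← h0]; simp only [Category.assoc, trans_proj]
      have h2 : (a ≫ p.strength A B) ≫ p.proj _ = x ≫ p.proj B := by
        simp only [x, Category.assoc, strength_proj]
      have e3 : (a ≫ prod.map (𝟙 A) ((trans φ).app B)) ≫ prod.snd = x ≫ (trans φ).app B := by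
        simp [x]
      have ex : a ≫ prod.map (𝟙 A) ((trans φ).app B) ≫ q.strength A B =
        (a ≫ prod.map (𝟙 A) ((trans φ).app B)) ≫ q.strength A B := by simp
      have ey : a ≫ p.strength A B ≫ (trans φ).app (A ⨯ B) =
        (a ≫ p.strength A B) ≫ (trans φ).app (A ⨯ B) := by simp
      have h3 : ((a ≫ p.strength A B) ≫ p.proj _) ≫ Hom.onBase φ = d ≫ q.hom := by
        rw [h2, h0]
      rw [evAt_congr q ex hx, evAt_congr q ey hy, evAt_strength q _ d _ (by rw [e3, h1]),
        evAt_congr q e3, evAt_trans φ x d h1 h0, evAt_trans φ _ d _ h3,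
        evAt_strength p a _ (by rw [Hom.app_hom]) (by rw [Hom.app_hom, h2])]
      apply prod.hom_ext
      · simp
      · simp only [prod.lift_snd]
        congr 1
        simp only [h2]

end Poly

variable (E) in
/-- The functor `P` from polynomials to strong endofunctors. -/
def polyFunctor : Poly E ⥤ StrongEndofunctor E where
  obj p := p.strongFunctor
  map φ := Poly.strongTrans φ
  map_id p := StrongEndofunctor.Hom.ext (Poly.trans_id p)
  map_comp φ ψ := StrongEndofunctor.Hom.ext (Poly.trans_comp φ ψ)

/-- The component `A ⟶ P(y)(A)` of the unit comparison. -/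
def unitComparison (A : E) : A ⟶ (Poly.y E).functor.obj A :=
  (Poly.y E).lift (terminal.from A) (pullback.fst _ _)

/-- The component `p(q(A)) ⟶ (p ◁ q)(A)` of the multiplication comparison: an element of `p(q(A))`
is sent to the element with position its image in `p(Q)`, whose value at a pair of compatible
directions of `p` and of `q` is obtained by evaluating at the first and then at the second. -/
def mulComparison (p q : Poly E) (A : E) :
    p.functor.obj (q.functor.obj A) ⟶ (p.tri q).functor.obj A :=
  have c₁ : pullback.fst (p.functor.map (q.proj A)) (p.tri q).hom ≫ p.proj (q.functor.obj A) =
      (pullback.snd (p.functor.map (q.proj A)) (p.tri q).hom ≫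
        (pullback.fst (p.ev q.base) q.hom ≫ pullback.snd (p.proj q.base) p.hom :
          (p.tri q).total ⟶ p.total)) ≫ p.hom := by
    have h := pullback.condition (f := p.functor.map (q.proj A)) (g := (p.tri q).hom)
    have h' := congrArg (fun k => k ≫ p.proj q.base) h
    refine Eq.trans ?_ (h'.trans ?_)
    · rw [Category.assoc, Poly.map_proj]
    · have key {T : E} (s : T ⟶ pullback (p.ev q.base) q.hom) :
          (s ≫ pullback.fst (p.ev q.base) q.hom ≫ pullback.fst (p.proj q.base) p.hom) ≫
            p.proj q.base =
          (s ≫ pullback.fst (p.ev q.base) q.hom ≫ pullback.snd (p.proj q.base) p.hom) ≫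
            p.hom := by
        simp only [Category.assoc, pullback.condition]
      exact key _
  have c₂ : p.evAt (pullback.fst (p.functor.map (q.proj A)) (p.tri q).hom)
      (pullback.snd (p.functor.map (q.proj A)) (p.tri q).hom ≫
        (pullback.fst (p.ev q.base) q.hom ≫ pullback.snd (p.proj q.base) p.hom :
          (p.tri q).total ⟶ p.total)) c₁ ≫ q.proj A =
      (pullback.snd (p.functor.map (q.proj A)) (p.tri q).hom ≫
        (pullback.snd (p.ev q.base) q.hom : (p.tri q).total ⟶ q.total)) ≫ q.hom := by
    have h := pullback.condition (f := p.functor.map (q.proj A)) (g := (p.tri q).hom)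
    have h' : (pullback.fst (p.functor.map (q.proj A)) (p.tri q).hom ≫
        p.functor.map (q.proj A)) ≫ p.proj q.base =
      (pullback.snd (p.functor.map (q.proj A)) (p.tri q).hom ≫
        (pullback.fst (p.ev q.base) q.hom ≫ pullback.snd (p.proj q.base) p.hom :
          (p.tri q).total ⟶ p.total)) ≫ p.hom := by
      rw [Category.assoc, Poly.map_proj, c₁]
    rw [← Poly.evAt_map p (q.proj A) _ _ c₁ h', Poly.evAt_congr p h, Poly.evAt_eq_lift_ev]
    have key {T : E} (s : T ⟶ pullback (p.ev q.base) q.hom) (c) :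
        pullback.lift (s ≫ pullback.fst (p.ev q.base) q.hom ≫
          pullback.fst (p.proj q.base) p.hom) (s ≫ pullback.fst (p.ev q.base) q.hom ≫
          pullback.snd (p.proj q.base) p.hom) c ≫ p.ev q.base =
        (s ≫ pullback.snd (p.ev q.base) q.hom) ≫ q.hom := by
      have e : (s ≫ pullback.snd (p.ev q.base) q.hom) ≫ q.hom =
          (s ≫ pullback.fst (p.ev q.base) q.hom) ≫ p.ev q.base := by
        simp only [Category.assoc, pullback.condition]
      rw [e]
      congr 1
      apply pullback.hom_ext <;> simp
    exact key _ _
  (p.tri q).lift (p.functor.map (q.proj A)) (q.evAt _ _ c₂)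

variable (E) in
/-- The data of a monoidal structure on the category of polynomials whose product is `◁` on objects
and whose unit is `y`. -/
structure TriStruct where
  /-- The functors `p ◁ -` on morphisms. -/
  whiskerLeft (p : Poly E) {q q' : Poly E} (ψ : q ⟶ q') : p.tri q ⟶ p.tri q'
  /-- The functors `- ◁ q` on morphisms. -/
  whiskerRight {p p' : Poly E} (φ : p ⟶ p') (q : Poly E) : p.tri q ⟶ p'.tri q
  /-- The functor `◁` on morphisms. -/
  tensorHom {p p' q q' : Poly E} (φ : p ⟶ p') (ψ : q ⟶ q') : p.tri q ⟶ p'.tri q'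
  /-- The associators. -/
  associator (p q r : Poly E) : (p.tri q).tri r ≅ p.tri (q.tri r)
  /-- The left unitors. -/
  leftUnitor (p : Poly E) : (Poly.y E).tri p ≅ p
  /-- The right unitors. -/
  rightUnitor (p : Poly E) : p.tri (Poly.y E) ≅ p

/-- The same data, in the form used by the notion of a monoidal category. -/
@[reducible]
def TriStruct.toStruct (S : TriStruct E) : MonoidalCategoryStruct (Poly E) where
  tensorObj := Poly.tri
  tensorUnit := Poly.y E
  whiskerLeft := S.whiskerLeft
  whiskerRight := S.whiskerRight
  tensorHom := S.tensorHom
  associator := S.associator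
  leftUnitor := S.leftUnitor
  rightUnitor := S.rightUnitor

variable (E) in
/-- A structure of monoidal category on the category of polynomials whose product is `◁` on objects
and whose unit is `y`. -/
structure TriMonoidal extends TriStruct E where
  /-- The axioms of a monoidal category hold. -/
  isMonoidal : ∃ M : MonoidalCategory (Poly E),
    M.toMonoidalCategoryStruct = toTriStruct.toStruct

/-- The monoidal category of polynomials given by a structure as above. -/
@[reducible]
def TriMonoidal.monoidalCategory (S : TriMonoidal E) : MonoidalCategory (Poly E) :=
  { S.toTriStruct.toStruct with
    tensorHom_def := by
      obtain ⟨M, hM⟩ := S.isMonoidal; rw [← hM]; exact M.tensorHom_def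
    id_tensorHom_id := by
      obtain ⟨M, hM⟩ := S.isMonoidal; rw [← hM]; exact M.id_tensorHom_id
    tensorHom_comp_tensorHom := by
      obtain ⟨M, hM⟩ := S.isMonoidal; rw [← hM]; exact M.tensorHom_comp_tensorHom
    whiskerLeft_id := by
      obtain ⟨M, hM⟩ := S.isMonoidal; rw [← hM]; exact M.whiskerLeft_id
    id_whiskerRight := by
      obtain ⟨M, hM⟩ := S.isMonoidal; rw [← hM]; exact M.id_whiskerRight
    associator_naturality := by
      obtain ⟨M, hM⟩ := S.isMonoidal; rw [← hM]; exact M.associator_naturality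
    leftUnitor_naturality := by
      obtain ⟨M, hM⟩ := S.isMonoidal; rw [← hM]; exact M.leftUnitor_naturality
    rightUnitor_naturality := by
      obtain ⟨M, hM⟩ := S.isMonoidal; rw [← hM]; exact M.rightUnitor_naturality
    pentagon := by
      obtain ⟨M, hM⟩ := S.isMonoidal; rw [← hM]; exact M.pentagon
    triangle := by
      obtain ⟨M, hM⟩ := S.isMonoidal; rw [← hM]; exact M.triangle }

end CatPoly

end

/-!
A morphism `T ⟶ p(A)` is a position `T ⟶ P` together with a value in `A` for each direction at it,
that is, a morphism `Poly.lift i g`. The *generic element* of `p(P_*)` has the identity of `P` as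
position and takes each direction to itself. Every element with values in `A` is the image under a
morphism `T ×_P P_* ⟶ A` of the element of `p(T ×_P P_*)` whose value at a direction is that
direction. Since `T ×_P P_*` embeds into `T × P_*`, where the latter element is built from a generic
element by the strength, a strong transformation out of `p` is determined by its value at the
generic element. When the target is `q(-)`, this value is an element of `q(P_*)`, that is, a
morphism of polynomials once its values lie in the right fibres, which compatibility with the
strength again guarantees.

By pasting of pullbacks, the fibre of `p ◁ q` at the position given by an element of `p(Q)` is the
object of compatible pairs of directions, so that `p(q(A)) ⟶ (p ◁ q)(A)` is bijective on elements.
The monoidal structure of the strong endofunctors is then transported along the fully faithful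
functor `P`, and the comparison isomorphisms force the result.
-/

noncomputable section

namespace CatPoly

lemma isPullback_fst_map {C : Type*} [Category* C] [HasPullbacks C] {S X Y Z : C} {f : X ⟶ Z}
    {g : Y ⟶ Z} {f' : S ⟶ Z} (a : S ⟶ X) (h : a ≫ f = f') :
    IsPullback (pullback.fst f' g) (pullback.map f' g f g a (𝟙 Y) (𝟙 Z) (by simp [h]) (by simp)) a
      (pullback.fst f g) := by
  have big : IsPullback (pullback.map f' g f g a (𝟙 Y) (𝟙 Z) (by simp [h]) (by simp) ≫
      pullback.snd f g)
      (pullback.fst f' g) g (a ≫ f) := by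
    simpa [pullback.map, pullback.lift_snd, ← h] using (IsPullback.of_hasPullback f' g).flip
  exact (big.of_right (pullback.lift_fst _ _ _) (IsPullback.of_hasPullback f g).flip).flip

variable {E : Type u} [Category.{v} E] [HasFiniteLimits E]

/-- Compatibility of a natural transformation with families of morphisms shaped like strengths; no
axiom of a strength is imposed on these families. -/
def IsStrong {F G : E ⥤ E} (τ : ∀ A B, A ⨯ F.obj B ⟶ F.obj (A ⨯ B))
    (σ : ∀ A B, A ⨯ G.obj B ⟶ G.obj (A ⨯ B)) (θ : F ⟶ G) : Prop :=
  ∀ A B, prod.map (𝟙 A) (θ.app B) ≫ σ A B = τ A B ≫ θ.app (A ⨯ B)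

namespace Poly

section Lift

variable (p : Poly E) {A B S T : E}

lemma evAt_eq_comp {x : S ⟶ p.functor.obj A} {d : S ⟶ p.total} {i : T ⟶ p.base}
    {g : pullback i p.hom ⟶ A} (b : S ⟶ pullback i p.hom)
    (hx : x = (b ≫ pullback.fst i p.hom) ≫ p.lift i g) (hd : d = b ≫ pullback.snd i p.hom)
    (h : x ≫ p.proj A = d ≫ p.hom) : p.evAt x d h = b ≫ g := by
  subst hx hd
  rw [evAt_lift]
  congr 1
  ext <;> simp only [pullback.lift_fst, pullback.lift_snd]

lemma fst_lift_proj (i : T ⟶ p.base) (g : pullback i p.hom ⟶ A) :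
    (pullback.fst i p.hom ≫ p.lift i g) ≫ p.proj A = pullback.snd i p.hom ≫ p.hom := by
  rw [Category.assoc, lift_proj, pullback.condition]

lemma eq_lift {x : T ⟶ p.functor.obj A} {i : T ⟶ p.base} {g : pullback i p.hom ⟶ A}
    (hi : x ≫ p.proj A = i)
    (hg : p.evAt (pullback.fst i p.hom ≫ x) (pullback.snd i p.hom)
      (by rw [Category.assoc, hi, pullback.condition]) = g) :
    x = p.lift i g := by
  subst hi hg
  refine p.functor_hom_ext _ _ (p.lift_proj _ _).symm fun S a d hx _ => ?_
  rw [evAt_lift, comp_evAt]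
  congr 1 <;> simp only [pullback.lift_fst_assoc, pullback.lift_snd]

lemma exists_lift_eq (x : T ⟶ p.functor.obj A) :
    ∃ (i : T ⟶ p.base) (g : pullback i p.hom ⟶ A), p.lift i g = x :=
  ⟨_, _, (p.eq_lift rfl rfl).symm⟩

lemma position_eq_of_lift_eq {i i' : T ⟶ p.base} {g : pullback i p.hom ⟶ A}
    {g' : pullback i' p.hom ⟶ A} (h : p.lift i g = p.lift i' g') : i = i' := by
  simpa only [lift_proj] using congrArg (· ≫ p.proj A) h

lemma lift_injective (i : T ⟶ p.base) :
    Function.Injective (p.lift i : (pullback i p.hom ⟶ A) → _) := by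
  intro g g' h
  rw [← Category.id_comp g, ← p.evAt_eq_comp (𝟙 _) (by simp) (by simp) (p.fst_lift_proj i g),
    p.evAt_eq_comp (g := g') (𝟙 _) (by simp [h]) (by simp), Category.id_comp]

lemma comp_lift (a : S ⟶ T) (i : T ⟶ p.base) (g : pullback i p.hom ⟶ A) :
    a ≫ p.lift i g = p.lift (a ≫ i)
      (pullback.map (a ≫ i) p.hom i p.hom a (𝟙 _) (𝟙 _) (by simp) (by simp) ≫ g) := by
  refine p.eq_lift (by rw [Category.assoc, lift_proj]) (p.evAt_eq_comp _ ?_ ?_ _)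
  · simp only [pullback.map, pullback.lift_fst, Category.assoc]
  · simp only [pullback.map, pullback.lift_snd, Category.comp_id]

lemma lift_map (i : T ⟶ p.base) (g : pullback i p.hom ⟶ A) (k : A ⟶ B) :
    p.lift i g ≫ p.functor.map k = p.lift i (g ≫ k) := by
  refine p.eq_lift (by rw [Category.assoc, map_proj, lift_proj]) ?_
  rw [p.evAt_congr (Category.assoc _ _ _).symm, p.evAt_map _ _ _ (p.fst_lift_proj i g), evAt_lift,
    pullback.lift_fst_snd, Category.id_comp]

lemma prod_lift_strength (c : T ⟶ A) (i : T ⟶ p.base) (g : pullback i p.hom ⟶ B) :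
    prod.lift c (p.lift i g) ≫ p.strength A B =
      p.lift i (prod.lift (pullback.fst i p.hom ≫ c) g) := by
  have snd_eq : (pullback.fst i p.hom ≫ prod.lift c (p.lift i g)) ≫ prod.snd =
      pullback.fst i p.hom ≫ p.lift i g := by rw [Category.assoc, prod.lift_snd]
  refine p.eq_lift (by rw [Category.assoc, strength_proj, prod.lift_snd_assoc, lift_proj]) ?_
  rw [p.evAt_congr (Category.assoc _ _ _).symm, evAt_strength, p.evAt_congr snd_eq, evAt_lift,
    pullback.lift_fst_snd, Category.id_comp, Category.assoc, prod.lift_fst]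
  rw [snd_eq, fst_lift_proj]

instance preservesMonomorphisms_functor : p.functor.PreservesMonomorphisms where
  preserves k _ := by
    refine ⟨fun x x' h => ?_⟩
    obtain ⟨i, g, rfl⟩ := p.exists_lift_eq x
    obtain ⟨i', g', rfl⟩ := p.exists_lift_eq x'
    rw [lift_map, lift_map] at h
    obtain rfl := p.position_eq_of_lift_eq h
    rw [(cancel_mono k).1 (p.lift_injective i h)]

end Lift

/-- The generic element of `p`: it takes values in the object of directions, with value `d` at the
direction `d`. -/
def generic (p : Poly E) : p.base ⟶ p.functor.obj p.total :=
  p.lift (𝟙 p.base) (pullback.snd (𝟙 p.base) p.hom)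

lemma generic_proj (p : Poly E) : p.generic ≫ p.proj p.total = 𝟙 p.base :=
  p.lift_proj _ _

lemma evAt_comp_generic (p : Poly E) {T : E} (i : T ⟶ p.base) (d : T ⟶ p.total)
    (h : (i ≫ p.generic) ≫ p.proj p.total = d ≫ p.hom) : p.evAt (i ≫ p.generic) d h = d :=
  (p.evAt_lift _ _ _ _ h).trans (pullback.lift_snd _ _ _)

lemma comp_generic (p : Poly E) {T : E} (i : T ⟶ p.base) :
    i ≫ p.generic = p.lift i (pullback.snd i p.hom) := by
  refine p.eq_lift (by rw [Category.assoc, generic_proj, Category.comp_id]) ?_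
  rw [p.evAt_congr (Category.assoc _ _ _).symm, evAt_comp_generic]

lemma generic_trans {p q : Poly E} (φ : p ⟶ q) :
    p.generic ≫ (trans φ).app p.total = q.lift (Hom.onBase φ) (Hom.onTotal φ) := by
  refine q.eq_lift ?_ ?_
  · rw [Category.assoc, trans_proj, ← Category.assoc, generic_proj, Category.id_comp]
  have position_eq :
      (pullback.fst (Hom.onBase φ) q.hom ≫ p.generic) ≫ p.proj p.total =
        pullback.fst (Hom.onBase φ) q.hom := by
    rw [Category.assoc, generic_proj, Category.comp_id]
  rw [q.evAt_congr (Category.assoc _ _ _).symm, evAt_trans, evAt_comp_generic]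
  · simp only [Hom.app, position_eq, pullback.lift_fst_snd, Category.id_comp]
  · rw [position_eq, pullback.condition]

lemma trans_injective {p q : Poly E} : Function.Injective (trans : (p ⟶ q) → _) := by
  intro φ ψ h
  have lift_eq : q.lift (Hom.onBase φ) (Hom.onTotal φ) =
      q.lift (Hom.onBase ψ) (Hom.onTotal ψ) := by
    rw [← generic_trans, h, generic_trans]
  obtain ⟨f, g, _⟩ := φ
  obtain ⟨f', g', _⟩ := ψ
  obtain rfl : f = f' := q.position_eq_of_lift_eq lift_eq
  obtain rfl : g = g' := q.lift_injective f lift_eq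
  rfl

section Strong

variable {p q : Poly E} {G : E ⥤ E} {θ θ' : p.functor ⟶ G}

lemma lift_app (θ : p.functor ⟶ G) {A T : E} (i : T ⟶ p.base) (g : pullback i p.hom ⟶ A) :
    p.lift i g ≫ θ.app A = p.lift i (𝟙 _) ≫ θ.app (pullback i p.hom) ≫ G.map g := by
  rw [← θ.naturality, ← Category.assoc, lift_map, Category.id_comp]

variable {σ : ∀ A B, A ⨯ G.obj B ⟶ G.obj (A ⨯ B)}

lemma lift_id_app (hθ : IsStrong p.strength σ θ) {T : E} (i : T ⟶ p.base) :
    p.lift i (𝟙 _) ≫ θ.app _ ≫ G.map (prod.lift (pullback.fst i p.hom) (pullback.snd i p.hom)) =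
      prod.lift (𝟙 T) (i ≫ p.generic ≫ θ.app p.total) ≫ σ T p.total := by
  rw [← lift_app, ← Category.comp_id (pullback.fst i p.hom), ← prod_lift_strength,
    ← comp_generic, Category.assoc, ← hθ, prod.lift_map_assoc, Category.id_comp, Category.assoc]

lemma eq_of_generic_comp_app_eq [G.PreservesMonomorphisms] (hθ : IsStrong p.strength σ θ)
    (hθ' : IsStrong p.strength σ θ')
    (h : p.generic ≫ θ.app p.total = p.generic ≫ θ'.app p.total) : θ = θ' := by
  have lift_id_app_eq {T : E} (i : T ⟶ p.base) :
      p.lift i (𝟙 _) ≫ θ.app _ = p.lift i (𝟙 _) ≫ θ'.app _ := by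
    rw [← cancel_mono (G.map (prod.lift (pullback.fst i p.hom) (pullback.snd i p.hom))),
      Category.assoc, lift_id_app hθ, h, ← lift_id_app hθ', Category.assoc]
  ext A
  obtain ⟨i, g, hx⟩ := p.exists_lift_eq (𝟙 (p.functor.obj A))
  rw [← Category.id_comp (θ.app A), ← Category.id_comp (θ'.app A), ← hx, lift_app, lift_app,
    ← Category.assoc, lift_id_app_eq, Category.assoc]

lemma generic_app_map_hom (hθ : IsStrong p.strength σ θ) :
    p.generic ≫ θ.app p.total ≫ G.map p.hom =
      prod.lift (𝟙 p.base) (p.generic ≫ θ.app p.total) ≫ σ p.base p.total ≫ G.map prod.fst := by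
  have h := congrArg (· ≫ G.map prod.fst) (lift_id_app hθ (𝟙 p.base))
  simp only [Category.assoc, ← G.map_comp, prod.lift_fst, Category.id_comp] at h
  rw [← h, ← Category.comp_id (pullback.fst _ _), pullback.condition, G.map_comp, ← Category.assoc,
    ← Category.assoc, generic, lift_app]
  simp only [Category.assoc]

lemma exists_trans_eq {θ : p.functor ⟶ q.functor} (hθ : IsStrong p.strength q.strength θ) :
    ∃ φ : p ⟶ q, trans φ = θ := by
  obtain ⟨f, g, hx⟩ := q.exists_lift_eq (p.generic ≫ θ.app p.total)
  have g_hom : g ≫ p.hom = pullback.fst f q.hom := by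
    apply q.lift_injective f
    have h := generic_app_map_hom hθ
    rw [← Category.assoc, ← hx, ← Category.assoc, lift_map, prod_lift_strength, lift_map,
      prod.lift_fst, Category.comp_id] at h
    exact h
  let φ : p ⟶ q := ⟨f, g, g_hom⟩
  exact ⟨φ, eq_of_generic_comp_app_eq (StrongEndofunctor.Hom.strong (strongTrans φ)) hθ
    ((generic_trans φ).trans hx)⟩

end Strong

end Poly

instance faithful_polyFunctor : (polyFunctor E).Faithful where
  map_injective h := Poly.trans_injective (congrArg StrongEndofunctor.Hom.natTrans h)

instance full_polyFunctor : (polyFunctor E).Full where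
  map_surjective θ := by
    obtain ⟨φ, hφ⟩ := Poly.exists_trans_eq (StrongEndofunctor.Hom.strong θ)
    exact ⟨φ, StrongEndofunctor.Hom.ext hφ⟩

namespace Poly

section Comparison

variable {p q : Poly E} {A B T : E} (i : T ⟶ p.base)

/-- The morphism into the domain of `p.ev A` classified by `p.lift i g`. -/
def toEvDomain (g : pullback i p.hom ⟶ A) : pullback i p.hom ⟶ pullback (p.proj A) p.hom :=
  pullback.map i p.hom (p.proj A) p.hom (p.lift i g) (𝟙 _) (𝟙 _)
    (by rw [lift_proj, Category.comp_id]) (by simp)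

lemma toEvDomain_ev (g : pullback i p.hom ⟶ A) : toEvDomain i g ≫ p.ev A = g := by
  simpa only [toEvDomain, pullback.map, Category.comp_id, evAt_eq_lift_ev, pullback.lift_fst_snd,
    Category.id_comp] using p.evAt_lift i g _ _ (p.fst_lift_proj i g)

variable (j : pullback i p.hom ⟶ q.base)

/-- The element `p.lift i j` of `p(Q)`, regarded as a position of `p ◁ q`. -/
def triPosition : T ⟶ (p.tri q).base :=
  p.lift i j

variable (p q) in
/-- The direction of `p` underlying a direction of `p ◁ q`. -/
def triFst : (p.tri q).total ⟶ p.total :=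
  pullback.fst (p.ev q.base) q.hom ≫ pullback.snd (p.proj q.base) p.hom

variable (p q) in
/-- The direction of `q` underlying a direction of `p ◁ q`. -/
def triSnd : (p.tri q).total ⟶ q.total :=
  pullback.snd (p.ev q.base) q.hom

/-- The direction of `p ◁ q` at the position `p.lift i j` given by a direction of `p` and a
compatible direction of `q`. -/
def triDirection : pullback j q.hom ⟶ (p.tri q).total :=
  pullback.map j q.hom (p.ev q.base) q.hom (toEvDomain i j) (𝟙 _) (𝟙 _)
    (by rw [toEvDomain_ev, Category.comp_id]) (by simp)

lemma triDirection_triFst :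
    triDirection i j ≫ triFst p q = pullback.fst j q.hom ≫ pullback.snd i p.hom :=
  (pullback.lift_fst_assoc _ _ _ _).trans ((Category.assoc _ _ _).trans
    (congrArg (pullback.fst j q.hom ≫ ·) ((pullback.lift_snd _ _ _).trans (Category.comp_id _))))

lemma triDirection_triSnd : triDirection i j ≫ triSnd p q = pullback.snd j q.hom :=
  (pullback.lift_snd _ _ _).trans (Category.comp_id _)

lemma isPullback_triDirection :
    IsPullback (pullback.fst j q.hom ≫ pullback.fst i p.hom) (triDirection i j) (triPosition i j)
      (p.tri q).hom := by
  have upper : IsPullback (pullback.fst j q.hom) (triDirection i j) (toEvDomain i j)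
      (pullback.fst (p.ev q.base) q.hom) := isPullback_fst_map _ (toEvDomain_ev i j)
  have lower : IsPullback (pullback.fst i p.hom) (toEvDomain i j) (p.lift i j)
      (pullback.fst (p.proj q.base) p.hom) := isPullback_fst_map _ (p.lift_proj i j)
  exact upper.paste_horiz lower

/-- The fibre of `p ◁ q` at the position `p.lift i j` consists of the compatible pairs of a
direction of `p` and a direction of `q`. -/
def triFiberIso : pullback j q.hom ≅ pullback (triPosition i j) (p.tri q).hom :=
  (isPullback_triDirection i j).isoPullback

lemma triFiberIso_inv_fst_fst :
    (triFiberIso i j).inv ≫ pullback.fst j q.hom ≫ pullback.fst i p.hom =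
      pullback.fst (triPosition i j) (p.tri q).hom :=
  (isPullback_triDirection i j).isoPullback_inv_fst

lemma triFiberIso_inv_fst_snd :
    ((triFiberIso i j).inv ≫ pullback.fst j q.hom) ≫ pullback.snd i p.hom =
      pullback.snd (triPosition i j) (p.tri q).hom ≫ triFst p q := by
  have direction : (triFiberIso i j).inv ≫ triDirection i j = _ :=
    (isPullback_triDirection i j).isoPullback_inv_snd
  rw [← direction, Category.assoc, Category.assoc, triDirection_triFst]

lemma triFiberIso_inv_snd :
    (triFiberIso i j).inv ≫ pullback.snd j q.hom =
      pullback.snd (triPosition i j) (p.tri q).hom ≫ triSnd p q := by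
  have direction : (triFiberIso i j).inv ≫ triDirection i j = _ :=
    (isPullback_triDirection i j).isoPullback_inv_snd
  rw [← direction, Category.assoc, triDirection_triSnd]

lemma lift_lift_mulComparison (k : pullback j q.hom ⟶ A) :
    p.lift i (q.lift j k) ≫ mulComparison p q A =
      (p.tri q).lift (triPosition i j) ((triFiberIso i j).inv ≫ k) := by
  have position_eq : p.lift i (q.lift j k) ≫ p.functor.map (q.proj A) = triPosition i j := by
    rw [lift_map, lift_proj, triPosition]
  have proj_eq : mulComparison p q A ≫ (p.tri q).proj A = p.functor.map (q.proj A) :=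
    lift_proj _ _ _
  refine (p.tri q).eq_lift (by rw [Category.assoc, proj_eq]; exact position_eq) ?_
  refine ((p.tri q).evAt_congr (Category.assoc _ _ _).symm _).trans
    (((p.tri q).evAt_lift _ _ _ _ _).trans ((q.comp_evAt _ _ _ _).trans ?_))
  refine q.evAt_eq_comp _ ((p.comp_evAt _ _ _ _).trans
    (p.evAt_eq_comp ((triFiberIso i j).inv ≫ pullback.fst j q.hom) ?_ ?_ _)) ?_ _
  · exact (pullback.lift_fst _ _ _).trans (congrArg (· ≫ p.lift i (q.lift j k))
      ((triFiberIso_inv_fst_fst i j).symm.trans (Category.assoc _ _ _).symm))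
  · exact (pullback.lift_snd_assoc _ _ _ _).trans (triFiberIso_inv_fst_snd i j).symm
  · exact (pullback.lift_snd_assoc _ _ _ _).trans (triFiberIso_inv_snd i j).symm

end Comparison

variable (p q : Poly E)

lemma exists_lift_lift_eq {A T : E} (x : T ⟶ p.functor.obj (q.functor.obj A)) :
    ∃ (i : T ⟶ p.base) (j : pullback i p.hom ⟶ q.base) (k : pullback j q.hom ⟶ A),
      p.lift i (q.lift j k) = x := by
  obtain ⟨i, g, rfl⟩ := p.exists_lift_eq x
  obtain ⟨j, k, rfl⟩ := q.exists_lift_eq g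
  exact ⟨i, j, k, rfl⟩

lemma comp_mulComparison_bijective (A T : E) :
    Function.Bijective
      (· ≫ mulComparison p q A : (T ⟶ p.functor.obj (q.functor.obj A)) → _) := by
  refine ⟨fun x x' h => ?_, fun z => ?_⟩
  · obtain ⟨i, j, k, rfl⟩ := exists_lift_lift_eq p q x
    obtain ⟨i', j', k', rfl⟩ := exists_lift_lift_eq p q x'
    simp only [lift_lift_mulComparison] at h
    have position_eq : p.lift i j = p.lift i' j' := (p.tri q).position_eq_of_lift_eq h
    obtain rfl := p.position_eq_of_lift_eq position_eq
    obtain rfl := p.lift_injective i position_eq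
    rw [(cancel_epi _).1 ((p.tri q).lift_injective _ h)]
  · obtain ⟨position, g, rfl⟩ := (p.tri q).exists_lift_eq z
    obtain ⟨i, j, rfl⟩ : ∃ i j, p.lift i j = position := p.exists_lift_eq position
    exact ⟨p.lift i (q.lift j ((triFiberIso i j).hom ≫ g)),
      (lift_lift_mulComparison i j _).trans (congrArg ((p.tri q).lift (triPosition i j))
        (Iso.inv_hom_id_assoc (triFiberIso i j) g))⟩

instance isIso_mulComparison (A : E) : IsIso (mulComparison p q A) :=
  isIso_of_yoneda_map_bijective _ (comp_mulComparison_bijective p q A)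

lemma mulComparison_naturality {A B : E} (k : A ⟶ B) :
    p.functor.map (q.functor.map k) ≫ mulComparison p q B =
      mulComparison p q A ≫ (p.tri q).functor.map k := by
  obtain ⟨i, j, g, hx⟩ := exists_lift_lift_eq p q (𝟙 (p.functor.obj (q.functor.obj A)))
  rw [← Category.id_comp (p.functor.map _), ← Category.id_comp (mulComparison p q A), ← hx,
    lift_map, lift_map, lift_lift_mulComparison, lift_lift_mulComparison, lift_map, Category.assoc]

lemma mulComparison_strength (A B : E) :
    prod.map (𝟙 A) (mulComparison p q B) ≫ (p.tri q).strength A B =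
      (p.strength A (q.functor.obj B) ≫ p.functor.map (q.strength A B)) ≫
        mulComparison p q (A ⨯ B) := by
  obtain ⟨i, j, k, hx⟩ :=
    exists_lift_lift_eq p q (prod.snd : A ⨯ p.functor.obj (q.functor.obj B) ⟶ _)
  have id_eq : prod.lift prod.fst (p.lift i (q.lift j k)) = 𝟙 _ := by
    rw [hx, prod.lift_fst_snd]
  rw [← Category.id_comp (prod.map _ _), ← Category.id_comp (p.strength A _), ← id_eq,
    prod.lift_map, Category.comp_id, lift_lift_mulComparison, prod_lift_strength,
    prod_lift_strength, lift_map, prod_lift_strength, lift_lift_mulComparison, prod.comp_lift,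
    ← triFiberIso_inv_fst_fst, Category.assoc, Category.assoc]

instance uniqueHomYBase (T : E) : Unique (T ⟶ (y E).base) :=
  inferInstanceAs (Unique (T ⟶ ⊤_ E))

instance isIso_y_hom : IsIso (y E).hom :=
  inferInstanceAs (IsIso (𝟙 (⊤_ E)))

lemma comp_unitComparison {A T : E} (x : T ⟶ A) (i : T ⟶ (y E).base) :
    x ≫ unitComparison A = (y E).lift i (pullback.fst i (y E).hom ≫ x) :=
  (y E).eq_lift (Subsingleton.elim _ _)
    (((y E).evAt_congr (Category.assoc _ _ _).symm _).trans
      (((y E).evAt_lift _ _ _ _ _).trans (pullback.lift_fst _ _ _)))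

lemma comp_unitComparison_bijective (A T : E) :
    Function.Bijective (· ≫ unitComparison A : (T ⟶ A) → _) := by
  refine ⟨fun x x' h => ?_, fun z => ?_⟩
  · simp only [comp_unitComparison _ default] at h
    exact (cancel_epi _).1 ((y E).lift_injective _ h)
  · obtain ⟨i, g, rfl⟩ := (y E).exists_lift_eq z
    refine ⟨inv (pullback.fst i (y E).hom) ≫ g, ?_⟩
    simp only [comp_unitComparison _ i, IsIso.hom_inv_id_assoc]

instance isIso_unitComparison (A : E) : IsIso (unitComparison A) :=
  isIso_of_yoneda_map_bijective _ (comp_unitComparison_bijective A)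

lemma unitComparison_naturality {A B : E} (k : A ⟶ B) :
    k ≫ unitComparison B = unitComparison A ≫ (y E).functor.map k := by
  rw [← Category.id_comp (unitComparison A), comp_unitComparison k default,
    comp_unitComparison (𝟙 A) default, lift_map, Category.comp_id]

lemma unitComparison_strength (A B : E) :
    prod.map (𝟙 A) (unitComparison B) ≫ (y E).strength A B = unitComparison (A ⨯ B) := by
  rw [← Category.id_comp (prod.map _ _), ← Category.id_comp (unitComparison (A ⨯ B)),
    ← prod.lift_fst_snd, prod.lift_map, Category.comp_id, comp_unitComparison _ default,
    comp_unitComparison _ default, prod_lift_strength, prod.comp_lift]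

end Poly

open MonoidalCategory

/-- The data of a monoidal functor which describe the image under it of the structure morphisms of
its source. -/
def inducingFunctorDataOfMonoidal {C D : Type*} [Category* C] [Category* D] [MonoidalCategory C]
    [MonoidalCategory D] (F : C ⥤ D) [F.Monoidal] : Monoidal.InducingFunctorData F where
  μIso := Functor.Monoidal.μIso F
  εIso := Functor.Monoidal.εIso F

namespace TriStruct

variable {D : Type*} [Category* D] [MonoidalCategory D] (F : Poly E ⥤ D)

section Transport

variable [F.Full] [F.Faithful] (εIso : 𝟙_ D ≅ F.obj (Poly.y E))
  (μIso : ∀ p q : Poly E, F.obj p ⊗ F.obj q ≅ F.obj (p.tri q))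

/-- The structure on polynomials obtained by transport along a fully faithful functor `F`, with the
given isomorphisms as comparison morphisms. -/
def transport : TriStruct E where
  whiskerLeft p {q q'} ψ := F.preimage ((μIso p q).inv ≫ F.obj p ◁ F.map ψ ≫ (μIso p q').hom)
  whiskerRight {p p'} φ q := F.preimage ((μIso p q).inv ≫ F.map φ ▷ F.obj q ≫ (μIso p' q).hom)
  tensorHom {p p' q q'} φ ψ :=
    F.preimage ((μIso p q).inv ≫ (F.map φ ⊗ₘ F.map ψ) ≫ (μIso p' q').hom)
  associator p q r := F.preimageIso
    (((μIso (p.tri q) r).symm ≪≫ ((μIso p q).symm ⊗ᵢ .refl _)) ≪≫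
      α_ (F.obj p) (F.obj q) (F.obj r) ≪≫ ((.refl _ ⊗ᵢ μIso q r) ≪≫ μIso p (q.tri r)))
  leftUnitor p := F.preimageIso
    (((μIso (Poly.y E) p).symm ≪≫ (εIso.symm ⊗ᵢ .refl _)) ≪≫ λ_ (F.obj p))
  rightUnitor p := F.preimageIso
    (((μIso p (Poly.y E)).symm ≪≫ (.refl _ ⊗ᵢ εIso.symm)) ≪≫ ρ_ (F.obj p))

/-- The functor `F` preserves the structure transported along it. -/
def transportInducingData :
    letI := (transport F εIso μIso).toStruct
    Monoidal.InducingFunctorData F :=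
  letI := (transport F εIso μIso).toStruct
  { μIso := μIso
    εIso := εIso
    whiskerLeft_eq := fun _ _ _ _ => F.map_preimage _
    whiskerRight_eq := fun _ _ => F.map_preimage _
    tensorHom_eq := fun _ _ => F.map_preimage _
    associator_eq := fun _ _ _ => F.map_preimage _
    leftUnitor_eq := fun _ => F.map_preimage _
    rightUnitor_eq := fun _ => F.map_preimage _ }

variable {F εIso μIso}

lemma eq_transport {S : TriStruct E} (d : letI := S.toStruct; Monoidal.InducingFunctorData F)
    (hε : letI := S.toStruct; d.εIso = εIso) (hμ : letI := S.toStruct; d.μIso = μIso) :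
    S = transport F εIso μIso := by
  let := S.toStruct
  subst hε hμ
  obtain ⟨l, r, t, a, lu, ru⟩ := S
  rw [transport, TriStruct.mk.injEq]
  refine ⟨?_, ?_, ?_, ?_, ?_, ?_⟩
  · funext p q q' ψ
    exact F.map_injective ((d.whiskerLeft_eq p ψ).trans (F.map_preimage _).symm)
  · funext p p' φ q
    exact F.map_injective ((d.whiskerRight_eq φ q).trans (F.map_preimage _).symm)
  · funext p p' q q' φ ψ
    exact F.map_injective ((d.tensorHom_eq φ ψ).trans (F.map_preimage _).symm)
  · funext p q r
    exact Iso.ext (F.map_injective ((d.associator_eq p q r).trans (F.map_preimage _).symm))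
  · funext p
    exact Iso.ext (F.map_injective ((d.leftUnitor_eq p).trans (F.map_preimage _).symm))
  · funext p
    exact Iso.ext (F.map_injective ((d.rightUnitor_eq p).trans (F.map_preimage _).symm))

end Transport

end TriStruct

namespace TriMonoidal

variable {D : Type*} [Category* D] [MonoidalCategory D] (F : Poly E ⥤ D) [F.Full] [F.Faithful]
  (εIso : 𝟙_ D ≅ F.obj (Poly.y E)) (μIso : ∀ p q : Poly E, F.obj p ⊗ F.obj q ≅ F.obj (p.tri q))

/-- The monoidal structure on polynomials transported along a fully faithful functor. -/
def transport : TriMonoidal E where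
  toTriStruct := TriStruct.transport F εIso μIso
  isMonoidal :=
    letI := (TriStruct.transport F εIso μIso).toStruct
    ⟨Monoidal.induced F (TriStruct.transportInducingData F εIso μIso), rfl⟩

/-- The functor along which a monoidal structure is transported is monoidal, with the given
comparison isomorphisms. -/
@[reducible]
def monoidalOfTransport :
    letI := (transport F εIso μIso).monoidalCategory
    F.Monoidal :=
  letI := (TriStruct.transport F εIso μIso).toStruct
  Monoidal.fromInducedMonoidal F (TriStruct.transportInducingData F εIso μIso)

variable {F εIso μIso}

lemma eq_transport {M : TriMonoidal E} (m : letI := M.monoidalCategory; F.Monoidal)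
    (hε : letI := M.monoidalCategory; Functor.LaxMonoidal.ε F = εIso.hom)
    (hμ : letI := M.monoidalCategory; ∀ p q, Functor.LaxMonoidal.μ F p q = (μIso p q).hom) :
    M = transport F εIso μIso := by
  let := M.monoidalCategory
  have toTriStruct_eq : M.toTriStruct = TriStruct.transport F εIso μIso :=
    TriStruct.eq_transport (inducingFunctorDataOfMonoidal F) (Iso.ext hε)
      (funext₂ fun p q => Iso.ext (hμ p q))
  obtain ⟨S, _⟩ := M
  obtain rfl : S = _ := toTriStruct_eq
  rfl

end TriMonoidal

lemma StrongEndofunctor.isIso_of_isIso_app {F G : StrongEndofunctor E} (α : F ⟶ G)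
    (h : ∀ A, IsIso ((Hom.natTrans α).app A)) : IsIso α := by
  have : IsIso (Hom.natTrans α) := NatIso.isIso_of_isIso_app _
  refine ⟨⟨inv (Hom.natTrans α), fun A B => ?_⟩, Hom.ext (IsIso.hom_inv_id (Hom.natTrans α)),
    Hom.ext (IsIso.inv_hom_id (Hom.natTrans α))⟩
  rw [NatIso.isIso_inv_app, NatIso.isIso_inv_app, IsIso.eq_comp_inv, Category.assoc, ← Hom.strong α,
    prod.map_map_assoc]
  simp

/-- The unit comparison as a strong natural transformation. -/
def unitComparisonHom : 𝟙_ (StrongEndofunctor E) ⟶ (polyFunctor E).obj (Poly.y E) where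
  natTrans :=
    { app := unitComparison
      naturality := fun _ _ k => Poly.unitComparison_naturality k }
  strong A B := (Poly.unitComparison_strength A B).trans (Category.id_comp _).symm

/-- The multiplication comparison as a strong natural transformation. -/
def mulComparisonHom (p q : Poly E) :
    (polyFunctor E).obj p ⊗ (polyFunctor E).obj q ⟶ (polyFunctor E).obj (p.tri q) where
  natTrans :=
    { app := mulComparison p q
      naturality := fun _ _ k => Poly.mulComparison_naturality p q k }
  strong A B := Poly.mulComparison_strength p q A B

instance isIso_unitComparisonHom : IsIso (unitComparisonHom (E := E)) :=
  StrongEndofunctor.isIso_of_isIso_app _ Poly.isIso_unitComparison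

instance isIso_mulComparisonHom (p q : Poly E) : IsIso (mulComparisonHom p q) :=
  StrongEndofunctor.isIso_of_isIso_app _ (Poly.isIso_mulComparison p q)

end CatPoly

end

theorem mainTheorem6 {E : Type u} [Category.{v} E] [HasFiniteLimits E] :
    (CatPoly.polyFunctor E).Full ∧ (CatPoly.polyFunctor E).Faithful ∧
      ∃! M : CatPoly.TriMonoidal E,
        letI := M.monoidalCategory
        ∃ _m : (CatPoly.polyFunctor E).Monoidal,
          (∀ A : E, (Functor.LaxMonoidal.ε (CatPoly.polyFunctor E)).natTrans.app A =
            CatPoly.unitComparison A) ∧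
          (∀ (p q : CatPoly.Poly E) (A : E),
            (Functor.LaxMonoidal.μ (CatPoly.polyFunctor E) p q).natTrans.app A =
              CatPoly.mulComparison p q A) := by
  refine ⟨inferInstance, inferInstance,
    CatPoly.TriMonoidal.transport (CatPoly.polyFunctor E) (asIso CatPoly.unitComparisonHom)
      (fun p q => asIso (CatPoly.mulComparisonHom p q)),
    ⟨CatPoly.TriMonoidal.monoidalOfTransport _ _ _, fun _ => rfl, fun _ _ _ => rfl⟩, ?_⟩
  rintro M ⟨m, hε, hμ⟩
  exact CatPoly.TriMonoidal.eq_transport m (CatPoly.StrongEndofunctor.hom_ext hε)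
    (fun p q => CatPoly.StrongEndofunctor.hom_ext (hμ p q))
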